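/- Let $M$ be a nonempty closed $C^\infty$ manifold of dimension $n$ (compact, Hausdorff, without boundary). A *flow* on $M$ is a $C^\infty$ action $(t,x)\mapsto\varphi^t(x)$ of the additive group $\mathbb R$ on $M$; it is *locally free* if for every $x\in M$ the isotropy group $\{t\in\mathbb R : \varphi^t(x)=x\}$ is discrete. A locally free flow $\varphi$ is *parameter rigid* if for every locally free $C^\infty$ flow $\psi$ on $M$ having the same orbits as $\varphi$ there exist a $C^\infty$ diffeomorphism $F$ of $M$ mapping each orbit onto itself and an automorphism $A$ of the topological group $\mathbb R$ (that is, $A(t)=ct$ with $c\neq 0$) such that $F(\varphi^t(x))=\psi^{A(t)}(F(x))$ for all $x\in M$ and $t\in\mathbb R$. Let $\varphi$ be a parameter rigid locally free $C^\infty$ flow on $M$. Then: 1. $\varphi$ is uniquely ergodic: there is exactly one Borel probability measure $\mu$ on $M$ with $(\varphi^t)_*\mu=\mu$ for all $t\in\mathbb R$. 2. $\varphi$ leaves a smooth volume invariant: there is a smooth positive density $\rho$ on $M$ with $(\varphi^t)^*\rho=\rho$ for all $t\in\mathbb R$; and, if $M$ is orientable, there is a smooth nowhere vanishing differential $n$-form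 $\omega$ on $M$ with $(\varphi^t)^*\omega=\omega$ for all $t\in\mathbb R$. -/

import Mathlib

open scoped Manifold ContDiff

noncomputable section

namespace ParamRigid

open MeasureTheory

/-! Throughout, `M` is a smooth `n`-manifold without boundary, modelled on `ℝⁿ`, and a flow is an
action of the additive group `ℝ` (Mathlib's `Flow ℝ M`). -/

section Flows

variable {M : Type*} [TopologicalSpace M]

/-- A locally free action of `ℝ` of class `C^∞`: the map `(t, x) ↦ φ t x` is smooth and all isotropy
groups `{t | φ t x = x}` are discrete (equivalently, `0` is isolated in each of them). -/
structure IsSmoothLocallyFree (n : ℕ) [ChartedSpace (EuclideanSpace ℝ (Fin n)) M]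
    (φ : Flow ℝ M) : Prop where
  smooth : ContMDiff (𝓘(ℝ, ℝ).prod (𝓡 n)) (𝓡 n) ∞ (fun p : ℝ × M => φ p.1 p.2)
  locallyFree : ∀ x : M, ∀ᶠ t in nhdsWithin (0 : ℝ) {0}ᶜ, φ t x ≠ x

/-- `φ` is parameter rigid: every smooth locally free action `ψ` of `ℝ` with the same orbit
foliation is conjugate to `φ`, up to an automorphism `A` of `ℝ`, by a diffeomorphism `F` that maps
each leaf (each orbit) onto itself. -/
def IsParameterRigid (n : ℕ) [ChartedSpace (EuclideanSpace ℝ (Fin n)) M] (φ : Flow ℝ M) : Prop :=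
  ∀ ψ : Flow ℝ M, IsSmoothLocallyFree n ψ → (∀ x, ψ.orbit x = φ.orbit x) →
    ∃ (F : M ≃ₘ⟮𝓡 n, 𝓡 n⟯ M) (A : ℝ ≃ₜ+ ℝ),
      (∀ x, F '' φ.orbit x = φ.orbit x) ∧ ∀ (x : M) (t : ℝ), F (φ t x) = ψ (A t) (F x)

/-- There is exactly one `φ`-invariant Borel probability measure. -/
def IsUniquelyErgodic [MeasurableSpace M] (φ : Flow ℝ M) : Prop :=
  ∃! μ : Measure M, IsProbabilityMeasure μ ∧ ∀ t : ℝ, MeasurePreserving (φ t) μ μ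

end Flows

section Forms

variable (n : ℕ) (M : Type*) [TopologicalSpace M] [ChartedSpace (EuclideanSpace ℝ (Fin n)) M]

/-- A real-valued function `η` of tangent `n`-frames is smooth if in each chart its value
`z ↦ η (∂₁, …, ∂ₙ)` on the coordinate vector fields is a smooth function. -/
def IsSmoothOnFrames (η : ∀ x : M, (Fin n → TangentSpace (𝓡 n) x) → ℝ) : Prop :=
  ∀ p : M, ContDiffOn ℝ ∞
    (fun z : EuclideanSpace ℝ (Fin n) =>
      η ((extChartAt (𝓡 n) p).symm z) (fun i =>
        mfderiv 𝓘(ℝ, EuclideanSpace ℝ (Fin n)) (𝓡 n) (extChartAt (𝓡 n) p).symm z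
          (EuclideanSpace.single i (1 : ℝ))))
    (extChartAt (𝓡 n) p).target

/-- A smooth volume form: a smooth nowhere vanishing differential form of degree `n = dim M`. -/
structure VolumeForm where
  toFun : ∀ x : M, TangentSpace (𝓡 n) x [⋀^Fin n]→ₗ[ℝ] ℝ
  smooth : IsSmoothOnFrames n M (fun x v => toFun x v)
  ne_zero : ∀ x, toFun x ≠ 0

/-- A smooth positive density, i.e. locally the absolute value of a smooth volume form. -/
structure PositiveDensity where
  toFun : ∀ x : M, (Fin n → TangentSpace (𝓡 n) x) → ℝ
  map_linear : ∀ (x : M) (A : TangentSpace (𝓡 n) x →ₗ[ℝ] TangentSpace (𝓡 n) x)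
    (v : Fin n → TangentSpace (𝓡 n) x),
    toFun x (fun i => A (v i)) = |LinearMap.det A| * toFun x v
  pos : ∀ (x : M) (v : Fin n → TangentSpace (𝓡 n) x), LinearIndependent ℝ v → 0 < toFun x v
  smooth : IsSmoothOnFrames n M toFun

/-- `M` is orientable: it is covered by compatible smooth charts all of whose coordinate changes
have positive Jacobian determinant. -/
def IsOrientable : Prop :=
  ∃ 𝒜 ⊆ IsManifold.maximalAtlas (𝓡 n) ∞ M,
    (∀ x : M, ∃ e ∈ 𝒜, x ∈ e.source) ∧
    ∀ e ∈ 𝒜, ∀ e' ∈ 𝒜, ∀ z ∈ (e.symm.trans e').source,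
      0 < (fderiv ℝ (fun w => e' (e.symm w)) z).det

end Forms

section Invariance

variable {n : ℕ} {M : Type*} [TopologicalSpace M] [ChartedSpace (EuclideanSpace ℝ (Fin n)) M]

/-- `(φ t)^* η = η` for all `t`. -/
def VolumeForm.IsInvariant (η : VolumeForm n M) (φ : Flow ℝ M) : Prop :=
  ∀ (t : ℝ) (x : M) (v : Fin n → TangentSpace (𝓡 n) x),
    η.toFun (φ t x) (fun i => mfderiv (𝓡 n) (𝓡 n) (φ t) x (v i)) = η.toFun x v

/-- `(φ t)^* ρ = ρ` for all `t`. -/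
def PositiveDensity.IsInvariant (ρ : PositiveDensity n M) (φ : Flow ℝ M) : Prop :=
  ∀ (t : ℝ) (x : M) (v : Fin n → TangentSpace (𝓡 n) x),
    ρ.toFun (φ t x) (fun i => mfderiv (𝓡 n) (𝓡 n) (φ t) x (v i)) = ρ.toFun x v

end Invariance

end ParamRigid

end

/-! The core is a cohomological statement: rigidity forces every smooth `g` to have orbit integrals
of the form u(φ^t x) − u(x) + ct with u smooth (`IsParameterRigid.isCohomologousToConst`). Both
conclusions follow from it.

To obtain it, take g ≥ 0 and let the speeds 1 + l·g, for l = 0, 1, 2, define new clocks on the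
orbits of φ. Rigidity conjugates φ to each of these time changes, up to a nonzero constant that may
reverse time. Two of the three constants share a sign, so two of the time changes, with speeds f₁
and f₂, are conjugate by a leaf-preserving F with a constant c > 0
(`IsParameterRigid.exists_isLeafConj`). Write F x = φ^{h(x)} x. Along an orbit segment, the f₂-clock
of the displacement h changes by c·(f₁-clock) − (f₂-clock), that is, by (c − 1)t + (c·l₁ − l₂)∫g.
Once h is known to be smooth and bounded, this solves the cohomological equation for g.

A priori h is neither continuous nor bounded. Baire's theorem bounds it on each minimal set, so
minimality of φ is proved first. If the speeds are constants a₁, a₂ on a minimal set, then c·a₁ =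
a₂; a `g` equal to 0 on one minimal set and 1 on another would therefore give l₁ = l₂, so the
minimal set K is unique. If K ≠ M, Baire's theorem off K produces an orbit whose total integral
against some bump function is finite. Using a small multiple of that bump as `g`, the clock of h
along this orbit has different limits at −∞ and +∞. Both limits are times of the flow realizing F on
K, and their difference is a forbidden short period. Hence φ is minimal. If it is free, h is unique,
continuous and smooth; otherwise M is one periodic orbit and the equation is solved directly.

For unique ergodicity, the constant of `g` is its integral against any invariant probability, and
smooth functions are uniformly dense in the continuous ones. For the volume, solving the equation
for the divergence of φ yields a smooth density multiplied by e^{ct} under φ^t, and c = 0 because M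
has finite volume. On an orientable M the density acquires a sign, which the flow preserves because
ℝ is connected. -/

namespace ParamRigid

open MeasureTheory Set Filter Topology

set_option linter.unusedSectionVars false

/-! ### Smoothness of implicit solutions and of parametric integrals -/

section Calculus

/-- A continuous solution of a nondegenerate smooth implicit equation is smooth. -/
theorem contDiffAt_of_implicit {E : Type*} [NormedAddCommGroup E] [NormedSpace ℝ E]
    [CompleteSpace E] {f : E × ℝ → ℝ} {h : E → ℝ} {x : E} {d : ℝ}
    (hf : ContDiffAt ℝ ∞ f (x, h x)) (hc : ContinuousAt h x)
    (h0 : ∀ᶠ y in 𝓝 x, f (y, h y) = f (x, h x))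
    (hd : HasDerivAt (fun t => f (x, t)) d (h x)) (hd0 : d ≠ 0) : ContDiffAt ℝ ∞ h x := by
  have pn : (∞ : WithTop ℕ∞) ≠ 0 := by simp
  have hdf : HasFDerivAt f (fderiv ℝ f (x, h x)) (x, h x) :=
    (hf.differentiableAt pn).hasFDerivAt
  have e1 : fderiv ℝ f (x, h x) (0, 1) = d := by
    have h1 : HasDerivAt (fun t : ℝ => (x, t)) ((0 : E), (1 : ℝ)) (h x) :=
      (hasDerivAt_const _ _).prodMk (hasDerivAt_id _)
    exact (hdf.comp_hasDerivAt (h x) h1).unique hd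
  have hinv : (fderiv ℝ f (x, h x) ∘L .inr ℝ E ℝ).IsInvertible := by
    refine ⟨ContinuousLinearEquiv.unitsEquivAut ℝ (Units.mk0 d hd0), ?_⟩
    ext
    simp [e1]
  have key := hf.eventually_apply_eq_iff_implicitFunction pn hinv
  have ht : Tendsto (fun y => (y, h y)) (𝓝 x) (𝓝 (x, h x)) :=
    (continuousAt_id.prodMk hc)
  have := (hf.contDiffAt_implicitFunction pn hinv)
  refine this.congr_of_eventuallyEq ?_
  filter_upwards [ht.eventually key, h0] with y hy h0y
  exact (hy.1 h0y).symm

theorem contMDiffAt_of_implicit {E H N : Type*} [NormedAddCommGroup E] [NormedSpace ℝ E]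
    [CompleteSpace E] [TopologicalSpace H] {I : ModelWithCorners ℝ E H} [I.Boundaryless]
    [TopologicalSpace N] [ChartedSpace H N] [IsManifold I ∞ N] {P : N × ℝ → ℝ} {h : N → ℝ} {x : N}
    {d : ℝ} (hP : ContMDiffAt (I.prod 𝓘(ℝ, ℝ)) 𝓘(ℝ, ℝ) ∞ P (x, h x)) (hc : ContinuousAt h x)
    (h0 : ∀ᶠ y in 𝓝 x, P (y, h y) = P (x, h x))
    (hd : HasDerivAt (fun t => P (x, t)) d (h x)) (hd0 : d ≠ 0) :
    ContMDiffAt I 𝓘(ℝ, ℝ) ∞ h x := by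
  set e := extChartAt I x with he
  have hxe : e.symm (e x) = x := extChartAt_to_inv x
  have hcs : ContinuousAt e.symm (e x) := continuousAt_extChartAt_symm x
  have hsm : ContMDiffAt 𝓘(ℝ, E) I ∞ e.symm (e x) := by
    have := (contMDiffOn_extChartAt_symm (I := I) (n := ∞) x).contMDiffAt
      (extChartAt_target_mem_nhds x)
    exact this
  have h1 : ContDiffAt ℝ ∞ (h ∘ e.symm) (e x) := by
    refine contDiffAt_of_implicit (f := fun p : E × ℝ => P (e.symm p.1, p.2)) (d := d)
      ?_ ?_ ?_ ?_ hd0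
    · have : ContMDiffAt 𝓘(ℝ, E × ℝ) 𝓘(ℝ, ℝ) ∞ (fun p : E × ℝ => P (e.symm p.1, p.2))
          (e x, (h ∘ e.symm) (e x)) := by
        have h2 : ContMDiffAt 𝓘(ℝ, E × ℝ) (I.prod 𝓘(ℝ, ℝ)) ∞ (fun p : E × ℝ => (e.symm p.1, p.2))
            (e x, (h ∘ e.symm) (e x)) := by
          refine ContMDiffAt.prodMk ?_ ?_
          · exact ContMDiffAt.comp (I' := 𝓘(ℝ, E)) _ hsm contDiffAt_fst.contMDiffAt
          · exact contDiffAt_snd.contMDiffAt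
        refine ContMDiffAt.comp (I' := I.prod 𝓘(ℝ, ℝ)) _ ?_ h2
        simpa [hxe] using hP
      exact this.contDiffAt
    · refine ContinuousAt.comp ?_ hcs
      rwa [hxe]
    · have : Tendsto e.symm (𝓝 (e x)) (𝓝 x) := by
        have := hcs.tendsto
        rwa [hxe] at this
      filter_upwards [this.eventually h0] with z hz
      simpa [hxe] using hz
    · simpa [hxe] using hd
  have h2 : ContMDiffAt I 𝓘(ℝ, ℝ) ∞ ((h ∘ e.symm) ∘ e) x :=
    ContMDiffAt.comp (I' := 𝓘(ℝ, E)) x h1.contMDiffAt contMDiffAt_extChartAt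
  refine h2.congr_of_eventuallyEq ?_
  filter_upwards [extChartAt_source_mem_nhds (I := I) x] with y hy
  change h y = h (e.symm (e y))
  rw [e.left_inv hy]

/-- The integral is the value at 0 of the convolution of the indicator of (0, 1] with s ↦ χ(s)·F(p,
−s). The cutoff χ equals 1 on [−1, 1], so the integral is unchanged, and it supplies the compact
support required for smoothness in the parameter. -/
theorem contDiffOn_intervalIntegral_param {P : Type*} [NormedAddCommGroup P] [NormedSpace ℝ P]
    {U : Set P} (hU : IsOpen U) {F : P → ℝ → ℝ}
    (hF : ContDiffOn ℝ ∞ (fun q : P × ℝ => F q.1 q.2) (U ×ˢ univ)) :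
    ContDiffOn ℝ ∞ (fun p => ∫ s in (0 : ℝ)..1, F p s) U := by
  let χ : ContDiffBump (0 : ℝ) := ⟨1, 2, one_pos, one_lt_two⟩
  let k : ℝ → ℝ := indicator (Ioc 0 1) 1
  have hk : LocallyIntegrable k volume := by
    refine Integrable.locallyIntegrable ?_
    rw [integrable_indicator_iff measurableSet_Ioc]
    exact integrableOn_const (by simp)
  have hg : ContDiffOn ℝ ∞ (fun q : P × ℝ => χ q.2 * F q.1 (-q.2)) (U ×ˢ univ) := by
    refine (χ.contDiff.comp contDiff_snd).contDiffOn.mul ?_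
    refine hF.comp (g := fun q : P × ℝ => F q.1 q.2)
      (contDiff_fst.prodMk contDiff_snd.neg).contDiffOn ?_
    rintro ⟨p, s⟩ ⟨hp, -⟩
    exact ⟨hp, trivial⟩
  have := contDiffOn_convolution_right_with_param_comp (n := ⊤) (μ := volume)
    (ContinuousLinearMap.mul ℝ ℝ) (v := fun _ : P => (0 : ℝ)) (s := U) contDiffOn_const (f := k)
    (g := fun p s => χ s * F p (-s)) (k := Metric.closedBall 0 2) hU
    (isCompact_closedBall _ _) ?_ hk hg
  · refine this.congr fun p hp => ?_
    rw [convolution_def, intervalIntegral.integral_of_le zero_le_one,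
      ← integral_indicator measurableSet_Ioc]
    congr 1
    ext s
    by_cases hs : s ∈ Ioc (0 : ℝ) 1
    · have : χ (-s) = 1 := χ.one_of_mem_closedBall (by
        simp only [Metric.mem_closedBall, dist_zero_right, norm_neg, Real.norm_eq_abs]
        rw [abs_of_pos hs.1]; exact hs.2)
      simp [k, hs, this]
    · simp [k, hs]
  · intro p s _ hs
    have : χ s = 0 := χ.zero_of_le_dist (by
      simp only [Metric.mem_closedBall, not_le] at hs; exact hs.le)
    simp [this]

end Calculus

/-! ### Integrals along orbit segments -/

section Clock

variable {n : ℕ} {M : Type*} [TopologicalSpace M] [ChartedSpace (EuclideanSpace ℝ (Fin n)) M]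

/-- The integral of `f` along the orbit segment of `x` of length `t`. -/
noncomputable def clock (φ : Flow ℝ M) (f : M → ℝ) (t : ℝ) (x : M) : ℝ := ∫ s in (0 : ℝ)..t, f (φ s x)

theorem continuous_orbitMap (φ : Flow ℝ M) (x : M) : Continuous fun t => φ t x :=
  φ.continuous continuous_id continuous_const

/-- Rescaling s to t·s fixes the interval of integration: the clock is t times an integral over [0,
1] depending smoothly on t and on the chart coordinate of x. -/
theorem contMDiff_clock [IsManifold (𝓡 n) ∞ M] {φ : Flow ℝ M} (hφ : IsSmoothLocallyFree n φ)
    {f : M → ℝ} (hf : ContMDiff (𝓡 n) 𝓘(ℝ, ℝ) ∞ f) :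
    ContMDiff (𝓘(ℝ, ℝ).prod (𝓡 n)) 𝓘(ℝ, ℝ) ∞ (fun p : ℝ × M => clock φ f p.1 p.2) := by
  rintro ⟨t₀, x₀⟩
  set e := extChartAt (𝓡 n) x₀ with he
  let E := EuclideanSpace ℝ (Fin n)
  have hop : IsOpen (univ ×ˢ e.target : Set (ℝ × E)) := isOpen_univ.prod (isOpen_extChartAt_target x₀)
  have h1 : ContDiffOn ℝ ∞ (fun q : ℝ × E => ∫ s in (0 : ℝ)..1, f (φ (q.1 * s) (e.symm q.2)))
      (univ ×ˢ e.target) := by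
    refine contDiffOn_intervalIntegral_param hop
      (F := fun (q : ℝ × E) s => f (φ (q.1 * s) (e.symm q.2))) ?_
    rw [← contMDiffOn_iff_contDiffOn]
    refine hf.comp_contMDiffOn ?_
    refine hφ.smooth.comp_contMDiffOn
      (f := fun q : (ℝ × E) × ℝ => (q.1.1 * q.2, e.symm q.1.2)) ?_
    refine ContMDiffOn.prodMk ?_ ?_
    · rw [contMDiffOn_iff_contDiffOn]
      exact ((contDiff_fst.fst).mul contDiff_snd).contDiffOn
    · refine (contMDiffOn_extChartAt_symm (I := 𝓡 n) (n := ∞) x₀).comp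
        (f := fun q : (ℝ × E) × ℝ => q.1.2) ?_ ?_
      · rw [contMDiffOn_iff_contDiffOn]
        exact (contDiff_fst.snd).contDiffOn
      · rintro ⟨⟨t, z⟩, s⟩ ⟨⟨-, hz⟩, -⟩
        exact hz
  have h2 : ContMDiffAt (𝓘(ℝ, ℝ).prod (𝓡 n)) 𝓘(ℝ, ℝ) ∞
      (fun p : ℝ × M => p.1 * ∫ s in (0 : ℝ)..1, f (φ (p.1 * s) (e.symm (e p.2)))) (t₀, x₀) := by
    refine ContMDiffAt.mul contMDiffAt_fst ?_
    have h3 : ContMDiffAt 𝓘(ℝ, ℝ × E) 𝓘(ℝ, ℝ) ∞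
        (fun q : ℝ × E => ∫ s in (0 : ℝ)..1, f (φ (q.1 * s) (e.symm q.2))) (t₀, e x₀) :=
      (h1.contDiffAt (hop.mem_nhds ⟨trivial, mem_extChartAt_target x₀⟩)).contMDiffAt
    refine ContMDiffAt.comp (I' := 𝓘(ℝ, ℝ × E)) (t₀, x₀) (f := fun p : ℝ × M => (p.1, e p.2)) h3 ?_
    rw [modelWithCornersSelf_prod, ← chartedSpaceSelf_prod]
    exact contMDiffAt_fst.prodMk
      (ContMDiffAt.comp (t₀, x₀) (g := e) (contMDiffAt_extChartAt) contMDiffAt_snd)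
  refine h2.congr_of_eventuallyEq ?_
  have : ∀ᶠ p : ℝ × M in 𝓝 (t₀, x₀), p.2 ∈ e.source :=
    continuousAt_snd.eventually (extChartAt_source_mem_nhds (I := 𝓡 n) x₀)
  filter_upwards [this] with p hp
  rw [e.left_inv hp, clock]
  have := intervalIntegral.mul_integral_comp_mul_left (a := 0) (b := 1) (c := p.1)
    (f := fun s => f (φ s p.2))
  simpa using this.symm

end Clock

/-! ### The generating vector field -/

section Generator

variable {n : ℕ} {M : Type*} [TopologicalSpace M] [ChartedSpace (EuclideanSpace ℝ (Fin n)) M]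
  [IsManifold (𝓡 n) ∞ M]

theorem IsSmoothLocallyFree.contMDiff_orbitMap {φ : Flow ℝ M} (hφ : IsSmoothLocallyFree n φ) (x : M) :
    ContMDiff 𝓘(ℝ, ℝ) (𝓡 n) ∞ (fun t => φ t x) :=
  hφ.smooth.comp (contMDiff_id.prodMk contMDiff_const)

theorem IsSmoothLocallyFree.contMDiff_apply {φ : Flow ℝ M} (hφ : IsSmoothLocallyFree n φ) (t : ℝ) :
    ContMDiff (𝓡 n) (𝓡 n) ∞ (φ t) :=
  hφ.smooth.comp (f := fun x => (t, x)) (contMDiff_const.prodMk contMDiff_id)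

/-- The generator of a locally free flow does not vanish. -/
theorem IsSmoothLocallyFree.mfderiv_orbitMap_ne_zero {φ : Flow ℝ M} (hφ : IsSmoothLocallyFree n φ)
    (x : M) : mfderiv 𝓘(ℝ, ℝ) (𝓡 n) (fun t => φ t x) 0 ≠ 0 := by
  intro h0
  have hmd : ∀ t, MDifferentiableAt 𝓘(ℝ, ℝ) (𝓡 n) (fun t => φ t x) t := fun t =>
    (hφ.contMDiff_orbitMap x).mdifferentiableAt (by simp)
  -- Since φ^s = φ^t ∘ φ^{s−t}, the velocity at time t is the image under dφ^t of the velocity at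
  -- time 0.
  have hz : ∀ t, mfderiv 𝓘(ℝ, ℝ) (𝓡 n) (fun t => φ t x) t = 0 := by
    intro t
    have e1 : (fun s => φ s x) = (φ t) ∘ (fun s => φ s x) ∘ (fun s => -t + s) := by
      ext s
      simp [← φ.map_add]
    have h1 : HasMFDerivAt 𝓘(ℝ, ℝ) 𝓘(ℝ, ℝ) (fun s : ℝ => -t + s) t (ContinuousLinearMap.id ℝ ℝ) :=
      ((hasFDerivAt_id t).const_add (-t)).hasMFDerivAt
    have h2 : HasMFDerivAt 𝓘(ℝ, ℝ) (𝓡 n) (fun s => φ s x) (-t + t)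
        (mfderiv 𝓘(ℝ, ℝ) (𝓡 n) (fun t => φ t x) (-t + t)) := (hmd _).hasMFDerivAt
    have h3 : HasMFDerivAt (𝓡 n) (𝓡 n) (φ t) (φ (-t + t) x)
        (mfderiv (𝓡 n) (𝓡 n) (φ t) (φ (-t + t) x)) :=
      ((hφ.contMDiff_apply t).mdifferentiableAt (by simp)).hasMFDerivAt
    have h4 := (h3.comp t (h2.comp t h1))
    have h5 : (mfderiv 𝓘(ℝ, ℝ) (𝓡 n) (fun t => φ t x) (-t + t)) = 0 := by
      rw [neg_add_cancel]; exact h0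
    have h6 := h4.mfderiv
    rw [← e1] at h6
    rw [h6]
    refine ContinuousLinearMap.ext fun c => ?_
    change mfderiv (𝓡 n) (𝓡 n) (φ t) (φ (-t + t) x)
      (mfderiv 𝓘(ℝ, ℝ) (𝓡 n) (fun t => φ t x) (-t + t) c) = 0
    rw [h5]
    exact map_zero _
  set e := extChartAt (𝓡 n) x with he
  have hsrc : ∀ᶠ t in 𝓝 (0 : ℝ), φ t x ∈ e.source := by
    refine (continuous_orbitMap φ x).continuousAt.eventually (p := fun y => y ∈ e.source) ?_
    simp only [φ.map_zero_apply]
    exact extChartAt_source_mem_nhds (I := 𝓡 n) x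
  obtain ⟨ε, hε, hball⟩ := Metric.eventually_nhds_iff_ball.1 hsrc
  have hder : ∀ t ∈ Metric.ball (0 : ℝ) ε, HasDerivAt (fun t => e (φ t x)) 0 t := by
    intro t ht
    have h1 : HasMFDerivAt (𝓡 n) 𝓘(ℝ, EuclideanSpace ℝ (Fin n)) e (φ t x)
        (mfderiv (𝓡 n) 𝓘(ℝ, EuclideanSpace ℝ (Fin n)) e (φ t x)) :=
      (mdifferentiableAt_extChartAt (by
        have := hball t ht
        rwa [he, extChartAt_source] at this)).hasMFDerivAt
    have h2 := h1.comp t (hmd t).hasMFDerivAt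
    rw [hz t] at h2
    have h3 : HasFDerivAt (fun t => e (φ t x)) (0 : ℝ →L[ℝ] EuclideanSpace ℝ (Fin n)) t := by
      rw [ContinuousLinearMap.comp_zero] at h2
      exact h2.hasFDerivAt
    simpa using h3.hasDerivAt
  have hconst : ∀ t ∈ Metric.ball (0 : ℝ) ε, φ t x = x := by
    intro t ht
    have h1 : e (φ t x) = e (φ 0 x) := by
      refine (convex_ball (0 : ℝ) ε).is_const_of_fderivWithin_eq_zero (𝕜 := ℝ)
        (f := fun t => e (φ t x)) (fun s hs => (hder s hs).differentiableAt.differentiableWithinAt)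
        (fun s hs => ?_) ht (Metric.mem_ball_self hε)
      rw [fderivWithin_of_isOpen Metric.isOpen_ball hs]
      rw [(hder s hs).hasFDerivAt.fderiv]
      ext; simp
    have h2 := e.injOn (hball t ht) (hball 0 (Metric.mem_ball_self hε)) h1
    rw [h2, φ.map_zero_apply]
  have h7 : ∀ᶠ t in 𝓝[≠] (0 : ℝ), φ t x = x :=
    eventually_nhdsWithin_of_eventually_nhds (Metric.eventually_nhds_iff_ball.2 ⟨ε, hε, hconst⟩)
  obtain ⟨t, ht1, ht2⟩ := (h7.and (hφ.locallyFree x)).exists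
  exact ht2 ht1

/-- Near each point there is a smooth function that is strictly monotone along the flow. -/
theorem IsSmoothLocallyFree.exists_transverse_function {φ : Flow ℝ M}
    (hφ : IsSmoothLocallyFree n φ) (x : M) :
    ∃ (q : M → ℝ) (d : ℝ), ContMDiffAt (𝓡 n) 𝓘(ℝ, ℝ) ∞ q x ∧ d ≠ 0 ∧
      HasDerivAt (fun t => q (φ t x)) d 0 := by
  set e := extChartAt (𝓡 n) x with he
  let γ' := mfderiv 𝓘(ℝ, ℝ) (𝓡 n) (fun t => φ t x) 0
  have h1 : HasMFDerivAt (𝓡 n) 𝓘(ℝ, EuclideanSpace ℝ (Fin n)) e (φ 0 x)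
        (mfderiv (𝓡 n) 𝓘(ℝ, EuclideanSpace ℝ (Fin n)) e (φ 0 x)) :=
      (mdifferentiableAt_extChartAt (by simp)).hasMFDerivAt
  have h2 := h1.comp (0 : ℝ) ((hφ.contMDiff_orbitMap x).mdifferentiableAt (x := 0) (by simp)).hasMFDerivAt
  let D : ℝ →L[ℝ] EuclideanSpace ℝ (Fin n) :=
    (mfderiv (𝓡 n) 𝓘(ℝ, EuclideanSpace ℝ (Fin n)) e (φ 0 x)).comp γ'
  have h3 : HasDerivAt (fun t => e (φ t x)) (D 1) 0 := by
    have : HasFDerivAt (fun t => e (φ t x)) D 0 := h2.hasFDerivAt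
    exact this.hasDerivAt
  set v : EuclideanSpace ℝ (Fin n) := D 1 with hv
  have hv0 : v ≠ 0 := by
    intro h0
    have hinj : Function.Injective (mfderiv (𝓡 n) 𝓘(ℝ, EuclideanSpace ℝ (Fin n)) e (φ 0 x)) := by
      have := isInvertible_mfderiv_extChartAt (I := 𝓡 n) (x := x) (y := φ 0 x) (by simp)
      exact this.injective
    have h4 : γ' (1 : ℝ) = 0 := by
      apply hinj
      rw [map_zero]
      exact h0
    apply hφ.mfderiv_orbitMap_ne_zero x
    refine ContinuousLinearMap.ext fun c => ?_
    have h5 : c = (show ℝ from c) • (show TangentSpace 𝓘(ℝ, ℝ) (0 : ℝ) from (1 : ℝ)) :=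
      (mul_one (show ℝ from c)).symm
    change γ' c = 0
    rw [h5, map_smul]
    exact (congrArg _ h4).trans (smul_zero _)
  -- The function is the coordinate in the direction of the velocity v of the orbit, so its
  -- derivative along the flow at x is ⟨v, v⟩.
  refine ⟨fun y => inner ℝ v (e y), inner ℝ v v, ?_, ?_, ?_⟩
  · refine ContMDiffAt.comp (I' := 𝓘(ℝ, EuclideanSpace ℝ (Fin n))) x (g := fun z => inner ℝ v z) ?_
      contMDiffAt_extChartAt
    exact (contDiff_const.inner ℝ contDiff_id).contDiffAt.contMDiffAt
  · simpa using hv0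
  · have := (hasDerivAt_const (0 : ℝ) v).inner ℝ h3
    rw [inner_zero_left, add_zero] at this
    exact this

end Generator

/-! ### Additivity and growth of clocks -/

section ClockBasic

variable {M : Type*} [TopologicalSpace M] {φ : Flow ℝ M} {f : M → ℝ}

@[simp]
theorem clock_zero (x : M) : clock φ f 0 x = 0 := intervalIntegral.integral_same

theorem continuous_comp_orbitMap (hf : Continuous f) (x : M) : Continuous fun t => f (φ t x) :=
  hf.comp (continuous_orbitMap φ x)

theorem hasDerivAt_clock (hf : Continuous f) (t : ℝ) (x : M) :
    HasDerivAt (fun t => clock φ f t x) (f (φ t x)) t :=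
  intervalIntegral.integral_hasDerivAt_right ((continuous_comp_orbitMap hf x).intervalIntegrable _ _)
    ((continuous_comp_orbitMap hf x).stronglyMeasurableAtFilter _ _)
    (continuous_comp_orbitMap hf x).continuousAt

theorem clock_add (hf : Continuous f) (s t : ℝ) (x : M) :
    clock φ f (s + t) x = clock φ f s x + clock φ f t (φ s x) := by
  have h : clock φ f t (φ s x) = ∫ r in s..s + t, f (φ r x) := by
    have := intervalIntegral.integral_comp_add_right (a := 0) (b := t)
      (fun r => f (φ r x)) s
    simp only [zero_add, φ.map_add] at this
    rw [clock, this, add_comm t s]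
  rw [h, clock, clock, intervalIntegral.integral_add_adjacent_intervals]
  all_goals exact (continuous_comp_orbitMap hf x).intervalIntegrable _ _

theorem clock_mono_of_nonneg (hf : Continuous f) (h0 : ∀ x, 0 ≤ f x) (x : M) :
    Monotone fun t => clock φ f t x := by
  refine monotone_of_deriv_nonneg (fun t => (hasDerivAt_clock hf t x).differentiableAt) fun t => ?_
  rw [(hasDerivAt_clock hf t x).deriv]
  exact h0 _

theorem mul_sub_le_clock_sub (hf : Continuous f) {δ : ℝ} (hδ : ∀ x, δ ≤ f x) {s t : ℝ} (hst : s ≤ t)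
    (x : M) : δ * (t - s) ≤ clock φ f t x - clock φ f s x := by
  have h1 : Monotone fun t => clock φ f t x - δ * t := by
    have hd : ∀ t, HasDerivAt (fun t => clock φ f t x - δ * t) (f (φ t x) - δ) t := fun t => by
      simpa using! (hasDerivAt_clock hf t x).sub ((hasDerivAt_id t).const_mul δ)
    refine monotone_of_deriv_nonneg (fun t => (hd t).differentiableAt) fun t => ?_
    rw [(hd t).deriv]
    linarith [hδ (φ t x)]
  have := h1 hst
  simp only at this
  linarith

theorem mul_abs_sub_le_abs_clock_sub (hf : Continuous f) {δ : ℝ} (hδ : ∀ x, δ ≤ f x)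
    (s t : ℝ) (x : M) : δ * |t - s| ≤ |clock φ f t x - clock φ f s x| := by
  rcases le_total s t with h | h
  · rw [abs_of_nonneg (sub_nonneg.2 h)]
    exact (mul_sub_le_clock_sub hf hδ h x).trans (le_abs_self _)
  · rw [abs_sub_comm, abs_sub_comm (clock φ f t x), abs_of_nonneg (sub_nonneg.2 h)]
    exact (mul_sub_le_clock_sub hf hδ h x).trans (le_abs_self _)

theorem clock_sub_fun {g : M → ℝ} (hf : Continuous f) (hg : Continuous g) (a b t : ℝ) (x : M) :
    clock φ (fun y => a * f y + b * g y) t x = a * clock φ f t x + b * clock φ g t x := by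
  simp only [clock]
  rw [intervalIntegral.integral_add, intervalIntegral.integral_const_mul,
    intervalIntegral.integral_const_mul]
  · exact ((continuous_comp_orbitMap hf x).const_mul a).intervalIntegrable _ _
  · exact ((continuous_comp_orbitMap hg x).const_mul b).intervalIntegrable _ _

theorem clock_one_add_mul {g : M → ℝ} (hg : Continuous g) (l t : ℝ) (x : M) :
    clock φ (fun y => 1 + l * g y) t x = t + l * clock φ g t x := by
  have := clock_sub_fun (φ := φ) (f := fun _ => 1) (g := g) continuous_const hg 1 l t x
  simp only [mul_one, one_mul] at this
  rw [this]
  simp [clock]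

theorem clock_eq_mul_of_orbit {a : ℝ} {x : M} (h : ∀ t, f (φ t x) = a) (t : ℝ) :
    clock φ f t x = a * t := by
  simp [clock, h, mul_comm]

theorem clock_bijective (hf : Continuous f) {δ : ℝ} (hδ0 : 0 < δ) (hδ : ∀ x, δ ≤ f x) (x : M) :
    Function.Bijective fun t => clock φ f t x := by
  refine ⟨fun s t hst => ?_, ?_⟩
  · have := mul_abs_sub_le_abs_clock_sub (φ := φ) hf hδ s t x
    simp only at hst
    rw [hst, sub_self, abs_zero] at this
    have h2 : |t - s| ≤ 0 := by
      by_contra! h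
      nlinarith
    linarith [abs_nonpos_iff.1 h2]
  · have hc : Continuous fun t => clock φ f t x :=
      continuous_iff_continuousAt.2 fun t => (hasDerivAt_clock hf t x).continuousAt
    refine hc.surjective ?_ ?_
    · refine tendsto_atTop_mono' _ ?_ (tendsto_id.const_mul_atTop hδ0)
      filter_upwards [eventually_ge_atTop 0] with t ht
      simpa using mul_sub_le_clock_sub (φ := φ) hf hδ ht x
    · refine tendsto_atBot_mono' _ ?_ (tendsto_id.const_mul_atBot hδ0)
      filter_upwards [eventually_le_atBot 0] with t ht
      have := mul_sub_le_clock_sub (φ := φ) hf hδ ht x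
      simp at this
      simpa using this

end ClockBasic

/-! ### Time changes and the conjugacies given by rigidity -/

section TimeChange

variable {n : ℕ} {M : Type*} [TopologicalSpace M] [ChartedSpace (EuclideanSpace ℝ (Fin n)) M]

/-- A smooth function on `M` bounded below by a positive constant. -/
structure IsSpeed (n : ℕ) {M : Type*} [TopologicalSpace M]
    [ChartedSpace (EuclideanSpace ℝ (Fin n)) M] (f : M → ℝ) (δ : ℝ) : Prop where
  smooth : ContMDiff (𝓡 n) 𝓘(ℝ, ℝ) ∞ f
  pos : 0 < δ
  le : ∀ x, δ ≤ f x

/-- The inverse of the clock of an orbit. -/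
noncomputable def unclock (φ : Flow ℝ M) (f : M → ℝ) (s : ℝ) (x : M) : ℝ :=
  Function.invFun (fun t => clock φ f t x) s

variable {φ : Flow ℝ M} {f : M → ℝ} {δ : ℝ}

theorem IsSpeed.continuous (hf : IsSpeed n f δ) : Continuous f := hf.smooth.continuous

theorem IsSpeed.clock_injective (hf : IsSpeed n f δ) (x : M) :
    Function.Injective fun t => clock φ f t x :=
  (clock_bijective hf.continuous hf.pos hf.le x).1

theorem IsSpeed.clock_unclock (hf : IsSpeed n f δ) (s : ℝ) (x : M) :
    clock φ f (unclock φ f s x) x = s :=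
  Function.invFun_eq ((clock_bijective hf.continuous hf.pos hf.le x).2 s)

theorem IsSpeed.unclock_clock (hf : IsSpeed n f δ) (t : ℝ) (x : M) :
    unclock φ f (clock φ f t x) x = t :=
  hf.clock_injective (φ := φ) x (hf.clock_unclock _ x)

theorem IsSpeed.unclock_zero (hf : IsSpeed n f δ) (x : M) : unclock φ f 0 x = 0 := by
  simpa using hf.unclock_clock (φ := φ) 0 x

theorem IsSpeed.unclock_add (hf : IsSpeed n f δ) (s t : ℝ) (x : M) :
    unclock φ f (s + t) x = unclock φ f t x + unclock φ f s (φ (unclock φ f t x) x) := by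
  refine hf.clock_injective (φ := φ) x ?_
  simp only
  rw [clock_add hf.continuous, hf.clock_unclock, hf.clock_unclock, hf.clock_unclock, add_comm]

variable [IsManifold (𝓡 n) ∞ M]

/-- The lower bound δ on the speed makes the inverse clock Lipschitz in the clock value, which gives
continuity. Smoothness then comes from the implicit equation, whose time derivative is the speed
itself and so nonzero. -/
theorem IsSpeed.contMDiff_unclock (hφ : IsSmoothLocallyFree n φ) (hf : IsSpeed n f δ) :
    ContMDiff (𝓘(ℝ, ℝ).prod (𝓡 n)) 𝓘(ℝ, ℝ) ∞ (fun p : ℝ × M => unclock φ f p.1 p.2) := by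
  have hcl := contMDiff_clock hφ hf.smooth
  intro p₀
  set h : ℝ × M → ℝ := fun p => unclock φ f p.1 p.2 with hh
  have hcont : ContinuousAt h p₀ := by
    rw [ContinuousAt, tendsto_iff_dist_tendsto_zero]
    have h1 : Continuous fun p : ℝ × M => |p.1 - clock φ f (h p₀) p.2| / δ := by
      refine Continuous.div_const (Continuous.abs (continuous_fst.sub ?_)) _
      exact hcl.continuous.comp (continuous_const.prodMk continuous_snd)
    have h2 : Tendsto (fun p : ℝ × M => |p.1 - clock φ f (h p₀) p.2| / δ) (𝓝 p₀) (𝓝 0) := by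
      have := h1.tendsto p₀
      simpa [hh, hf.clock_unclock] using this
    refine squeeze_zero (fun _ => dist_nonneg) (fun p => ?_) h2
    rw [le_div_iff₀ hf.pos, Real.dist_eq, mul_comm]
    have := mul_abs_sub_le_abs_clock_sub (φ := φ) hf.continuous hf.le (h p₀) (h p) p.2
    rwa [hf.clock_unclock] at this
  refine contMDiffAt_of_implicit (I := 𝓘(ℝ, ℝ).prod (𝓡 n)) (N := ℝ × M)
    (P := fun q : (ℝ × M) × ℝ => clock φ f q.2 q.1.2 - q.1.1) (h := h) (x := p₀)
    (d := f (φ (h p₀) p₀.2)) ?_ hcont ?_ ?_ ?_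
  · refine ContMDiffAt.sub ?_ ?_
    · exact ContMDiffAt.comp (I' := 𝓘(ℝ, ℝ).prod (𝓡 n)) _
        (f := fun q : (ℝ × M) × ℝ => (q.2, q.1.2)) hcl.contMDiffAt
        (contMDiffAt_snd.prodMk (contMDiff_snd.comp contMDiff_fst).contMDiffAt)
    · exact (contMDiff_fst.comp contMDiff_fst).contMDiffAt
  · exact Eventually.of_forall fun p => by simp [hh, hf.clock_unclock]
  · exact (hasDerivAt_clock (φ := φ) hf.continuous (h p₀) p₀.2).sub_const p₀.1
  · exact (hf.pos.trans_le (hf.le _)).ne'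

/-- The flow with the same orbits as `φ` whose time is measured by the clock of `f`. -/
noncomputable def timeChange (hφ : IsSmoothLocallyFree n φ) (hf : IsSpeed n f δ) : Flow ℝ M where
  toFun s x := φ (unclock φ f s x) x
  cont' := by
    have h1 := (hf.contMDiff_unclock hφ).continuous
    exact φ.continuous h1 continuous_snd
  map_add' s t x := by
    rw [hf.unclock_add, add_comm, φ.map_add]
  map_zero' x := by
    rw [hf.unclock_zero, φ.map_zero_apply]

theorem timeChange_apply (hφ : IsSmoothLocallyFree n φ) (hf : IsSpeed n f δ) (s : ℝ) (x : M) :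
    timeChange hφ hf s x = φ (unclock φ f s x) x := rfl

theorem isSmoothLocallyFree_timeChange (hφ : IsSmoothLocallyFree n φ) (hf : IsSpeed n f δ) :
    IsSmoothLocallyFree n (timeChange hφ hf) where
  smooth := hφ.smooth.comp (f := fun p : ℝ × M => (unclock φ f p.1 p.2, p.2))
    ((hf.contMDiff_unclock hφ).prodMk contMDiff_snd)
  locallyFree x := by
    have hc : Continuous fun s => unclock φ f s x :=
      (hf.contMDiff_unclock hφ).continuous.comp (continuous_id.prodMk continuous_const)
    have ht : Tendsto (fun s => unclock φ f s x) (𝓝[≠] 0) (𝓝[≠] 0) := by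
      refine tendsto_nhdsWithin_iff.2 ⟨?_, ?_⟩
      · have := (hc.tendsto 0).mono_left (nhdsWithin_le_nhds (s := {0}ᶜ))
        rwa [hf.unclock_zero] at this
      · filter_upwards [self_mem_nhdsWithin] with s hs h0
        have := hf.clock_unclock (φ := φ) s x
        rw [h0, clock_zero] at this
        exact hs this.symm
    exact ht.eventually (hφ.locallyFree x)

theorem orbit_timeChange (hφ : IsSmoothLocallyFree n φ) (hf : IsSpeed n f δ) (x : M) :
    (timeChange hφ hf).orbit x = φ.orbit x := by
  ext y
  rw [Flow.mem_orbit_iff, Flow.mem_orbit_iff]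
  constructor
  · rintro ⟨s, rfl⟩
    exact ⟨_, rfl⟩
  · rintro ⟨t, rfl⟩
    exact ⟨clock φ f t x, by rw [timeChange_apply, hf.unclock_clock]⟩

/-- A leaf-preserving diffeomorphism that conjugates the time change of `φ` by `f₁` to the time
change by `f₂`, up to a positive constant `c`. -/
structure IsLeafConj (n : ℕ) {M : Type*} [TopologicalSpace M]
    [ChartedSpace (EuclideanSpace ℝ (Fin n)) M] (φ : Flow ℝ M) (f₁ f₂ : M → ℝ)
    (F : M → M) (c : ℝ) : Prop where
  smooth : ContMDiff (𝓡 n) (𝓡 n) ∞ F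
  injective : Function.Injective F
  exists_time : ∀ x, ∃ t, F x = φ t x
  pos : 0 < c
  conj : ∀ x t θ, clock φ f₂ θ (F x) = c * clock φ f₁ t x → F (φ t x) = φ θ (F x)

/-- A continuous automorphism of ℝ is multiplication by its value at 1. Stating the conjugacy
through the clock of `f` removes the inverse clock from all later computations. -/
theorem IsParameterRigid.exists_diffeomorph (hφ : IsSmoothLocallyFree n φ)
    (hr : IsParameterRigid n φ) (hf : IsSpeed n f δ) :
    ∃ (F : M ≃ₘ⟮𝓡 n, 𝓡 n⟯ M) (c : ℝ), (∀ x, F '' φ.orbit x = φ.orbit x) ∧ c ≠ 0 ∧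
      ∀ x t θ, clock φ f θ (F x) = c * t → F (φ t x) = φ θ (F x) := by
  obtain ⟨F, A, h1, h2⟩ := hr (timeChange hφ hf) (isSmoothLocallyFree_timeChange hφ hf)
    (orbit_timeChange hφ hf)
  have hA : ∀ t, A t = A 1 * t := fun t => by
    have := map_real_smul A A.continuous t 1
    simpa [mul_comm] using this
  refine ⟨F, A 1, h1, fun h0 => ?_, fun x t θ h => ?_⟩
  · have : A 1 = A 0 := by rw [h0, map_zero]
    exact one_ne_zero (A.injective this)
  · rw [h2, timeChange_apply, hA, ← h, hf.unclock_clock]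

/-- Passing through φ itself, F₂ ∘ F₁⁻¹ carries the first time change to the second, and the
constants divide. -/
theorem isLeafConj_of_same_sign {f₁ f₂ : M → ℝ} {F₁ F₂ : M ≃ₘ⟮𝓡 n, 𝓡 n⟯ M} {c₁ c₂ : ℝ} (h₁ : ∀ x, F₁ '' φ.orbit x = φ.orbit x)
    (h₂ : ∀ x, F₂ '' φ.orbit x = φ.orbit x)
    (h₁' : ∀ x t θ, clock φ f₁ θ (F₁ x) = c₁ * t → F₁ (φ t x) = φ θ (F₁ x))
    (h₂' : ∀ x t θ, clock φ f₂ θ (F₂ x) = c₂ * t → F₂ (φ t x) = φ θ (F₂ x))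
    (hc₁ : c₁ ≠ 0) (hc : 0 < c₂ / c₁) :
    IsLeafConj n φ f₁ f₂ (F₂ ∘ F₁.symm) (c₂ / c₁) where
  smooth := F₂.contMDiff.comp F₁.symm.contMDiff
  injective := F₂.injective.comp F₁.symm.injective
  exists_time x := by
    have hx : x ∈ F₁ '' φ.orbit x := by rw [h₁]; exact φ.mem_orbit_self x
    obtain ⟨y, hy, hyx⟩ := hx
    have : F₂ y ∈ φ.orbit x := by rw [← h₂ x]; exact mem_image_of_mem _ hy
    obtain ⟨t, ht⟩ := (φ.mem_orbit_iff).1 this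
    refine ⟨t, ?_⟩
    rw [ht, ← hyx]
    simp
  pos := hc
  conj x t θ h := by
    obtain ⟨z, hz⟩ := F₁.surjective x
    replace hz : F₁ z = x := hz
    subst hz
    have e1 : F₁ (φ (clock φ f₁ t (F₁ z) / c₁) z) = φ t (F₁ z) := by
      refine h₁' _ _ _ ?_
      field_simp
    simp only [Function.comp_apply, Diffeomorph.symm_apply_apply] at h ⊢
    rw [← e1, Diffeomorph.symm_apply_apply]
    refine h₂' _ _ _ ?_
    rw [h]
    ring

theorem isSpeed_one_add_mul {g : M → ℝ} (hg : ContMDiff (𝓡 n) 𝓘(ℝ, ℝ) ∞ g) (hg0 : ∀ x, 0 ≤ g x)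
    {l : ℝ} (hl : 0 ≤ l) : IsSpeed n (fun x => 1 + l * g x) 1 where
  smooth := contMDiff_const.add (contMDiff_const.mul hg)
  pos := one_pos
  le x := by
    have := mul_nonneg hl (hg0 x)
    linarith

/-- Among the time changes by `1`, `1 + g` and `1 + 2 g`, two are conjugate with a positive
constant. -/
theorem IsParameterRigid.exists_isLeafConj (hφ : IsSmoothLocallyFree n φ)
    (hr : IsParameterRigid n φ) {g : M → ℝ} (hg : ContMDiff (𝓡 n) 𝓘(ℝ, ℝ) ∞ g)
    (hg0 : ∀ x, 0 ≤ g x) :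
    ∃ (l₁ l₂ : ℝ) (F : M → M) (c : ℝ), 0 ≤ l₁ ∧ 0 ≤ l₂ ∧ l₁ ≤ 2 ∧ l₂ ≤ 2 ∧ l₁ ≠ l₂ ∧
      IsLeafConj n φ (fun x => 1 + l₁ * g x) (fun x => 1 + l₂ * g x) F c := by
  have key : ∀ l₁ l₂ : ℝ, 0 ≤ l₁ → 0 ≤ l₂ → l₁ ≤ 2 → l₂ ≤ 2 → l₁ ≠ l₂ →
      ∀ {F₁ F₂ : M ≃ₘ⟮𝓡 n, 𝓡 n⟯ M} {c₁ c₂ : ℝ}, (∀ x, F₁ '' φ.orbit x = φ.orbit x) →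
      (∀ x, F₂ '' φ.orbit x = φ.orbit x) →
      (∀ x t θ, clock φ (fun x => 1 + l₁ * g x) θ (F₁ x) = c₁ * t → F₁ (φ t x) = φ θ (F₁ x)) →
      (∀ x t θ, clock φ (fun x => 1 + l₂ * g x) θ (F₂ x) = c₂ * t → F₂ (φ t x) = φ θ (F₂ x)) →
      c₁ ≠ 0 → 0 < c₂ / c₁ → ∃ (l₁ l₂ : ℝ) (F : M → M) (c : ℝ), 0 ≤ l₁ ∧ 0 ≤ l₂ ∧ l₁ ≤ 2 ∧
        l₂ ≤ 2 ∧ l₁ ≠ l₂ ∧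
        IsLeafConj n φ (fun x => 1 + l₁ * g x) (fun x => 1 + l₂ * g x) F c :=
    fun l₁ l₂ h1 h2 h3 h4 h5 F₁ F₂ c₁ c₂ a1 a2 a3 a4 a5 a6 =>
      ⟨l₁, l₂, _, _, h1, h2, h3, h4, h5,
        isLeafConj_of_same_sign a1 a2 a3 a4 a5 a6⟩
  obtain ⟨F₀, c₀, a₀, b₀, d₀⟩ := hr.exists_diffeomorph hφ
    (isSpeed_one_add_mul hg hg0 (le_refl (0 : ℝ)))
  obtain ⟨F₁, c₁, a₁, b₁, d₁⟩ := hr.exists_diffeomorph hφ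
    (isSpeed_one_add_mul hg hg0 (zero_le_one (α := ℝ)))
  obtain ⟨F₂, c₂, a₂, b₂, d₂⟩ := hr.exists_diffeomorph hφ
    (isSpeed_one_add_mul hg hg0 (zero_le_two (α := ℝ)))
  -- Of three nonzero reals two have the same sign; their quotient is the positive constant.
  rcases lt_or_gt_of_ne b₀ with h0 | h0 <;> rcases lt_or_gt_of_ne b₁ with h1 | h1 <;>
    rcases lt_or_gt_of_ne b₂ with h2 | h2
  · exact key 0 1 (by norm_num) (by norm_num) (by norm_num) (by norm_num) (by norm_num)
      a₀ a₁ d₀ d₁ b₀ (div_pos_of_neg_of_neg h1 h0)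
  · exact key 0 1 (by norm_num) (by norm_num) (by norm_num) (by norm_num) (by norm_num)
      a₀ a₁ d₀ d₁ b₀ (div_pos_of_neg_of_neg h1 h0)
  · exact key 0 2 (by norm_num) (by norm_num) (by norm_num) (by norm_num) (by norm_num)
      a₀ a₂ d₀ d₂ b₀ (div_pos_of_neg_of_neg h2 h0)
  · exact key 1 2 (by norm_num) (by norm_num) (by norm_num) (by norm_num) (by norm_num)
      a₁ a₂ d₁ d₂ b₁ (div_pos h2 h1)
  · exact key 1 2 (by norm_num) (by norm_num) (by norm_num) (by norm_num) (by norm_num)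
      a₁ a₂ d₁ d₂ b₁ (div_pos_of_neg_of_neg h2 h1)
  · exact key 0 2 (by norm_num) (by norm_num) (by norm_num) (by norm_num) (by norm_num)
      a₀ a₂ d₀ d₂ b₀ (div_pos h2 h0)
  · exact key 0 1 (by norm_num) (by norm_num) (by norm_num) (by norm_num) (by norm_num)
      a₀ a₁ d₀ d₁ b₀ (div_pos h1 h0)
  · exact key 0 1 (by norm_num) (by norm_num) (by norm_num) (by norm_num) (by norm_num)
      a₀ a₁ d₀ d₁ b₀ (div_pos h1 h0)

end TimeChange

/-! ### Minimal sets and points of bounded displacement -/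

section MinimalSets

variable {M : Type*} [TopologicalSpace M]

/-- A minimal set of a flow. -/
structure IsMinimalSet (φ : Flow ℝ M) (K : Set M) : Prop where
  isClosed : IsClosed K
  nonempty : K.Nonempty
  invariant : ∀ t, ∀ x ∈ K, φ t x ∈ K
  eq_of_subset : ∀ L ⊆ K, IsClosed L → L.Nonempty → (∀ t, ∀ x ∈ L, φ t x ∈ L) → L = K

variable {φ : Flow ℝ M} {K : Set M}

theorem exists_isMinimalSet_subset [CompactSpace M] {C : Set M} (hC : IsClosed C)
    (hne : C.Nonempty) (hinv : ∀ t, ∀ x ∈ C, φ t x ∈ C) : ∃ K ⊆ C, IsMinimalSet φ K := by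
  let S : Set (Set M) := {L | IsClosed L ∧ L.Nonempty ∧ ∀ t, ∀ x ∈ L, φ t x ∈ L}
  obtain ⟨K, hKC, hK⟩ := zorn_superset_nonempty S (fun c hcS hc hcne => by
    refine ⟨⋂₀ c, ⟨isClosed_sInter fun L hL => (hcS hL).1, ?_, ?_⟩, fun L hL => sInter_subset_of_mem hL⟩
    · have : Nonempty c := hcne.to_subtype
      refine IsCompact.nonempty_sInter_of_directed_nonempty_isCompact_isClosed ?_
        (fun L hL => (hcS hL).2.1) (fun L hL => (hcS hL).1.isCompact) (fun L hL => (hcS hL).1)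
      intro a ha b hb
      rcases hc.total ha hb with h | h
      · exact ⟨a, ha, Subset.rfl, h⟩
      · exact ⟨b, hb, h, Subset.rfl⟩
    · intro t x hx L hL
      exact (hcS hL).2.2 t x (hx L hL)) C ⟨hC, hne, hinv⟩
  refine ⟨K, hKC, hK.prop.1, hK.prop.2.1, hK.prop.2.2, fun L hL h1 h2 h3 => ?_⟩
  exact (hL.antisymm (hK.le_of_le ⟨h1, h2, h3⟩ hL))

theorem invariant_closure {s : Set M} (h : ∀ t, ∀ x ∈ s, φ t x ∈ s) (t : ℝ) (x : M)
    (hx : x ∈ closure s) : φ t x ∈ closure s :=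
  map_mem_closure (φ.continuous_toFun t) hx (h t)

theorem apply_mem_orbit (x : M) (t : ℝ) (y : M) (hy : y ∈ φ.orbit x) : φ t y ∈ φ.orbit x :=
  φ.mem_orbit_of_mem_orbit t hy

theorem IsMinimalSet.closure_orbit (hK : IsMinimalSet φ K) {x : M} (hx : x ∈ K) :
    closure (φ.orbit x) = K := by
  refine hK.eq_of_subset _ (closure_minimal ?_ hK.isClosed) isClosed_closure
    (φ.nonempty_orbit x).closure (invariant_closure (apply_mem_orbit x))
  rintro y ⟨t, rfl⟩
  exact hK.invariant t x hx

/-- Every orbit in K is dense in K, so the preimages of V under the flow cover K; a finite subcover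
makes the hitting time uniform. -/
theorem IsMinimalSet.exists_time_mem_open [CompactSpace M] (hK : IsMinimalSet φ K) {V : Set M}
    (hV : IsOpen V) (hVK : (V ∩ K).Nonempty) : ∃ R : ℝ, ∀ x ∈ K, ∃ t, |t| ≤ R ∧ φ t x ∈ V := by
  obtain ⟨v, hvV, hvK⟩ := hVK
  have hcov : K ⊆ ⋃ t : ℝ, φ t ⁻¹' V := by
    intro x hx
    have : v ∈ closure (φ.orbit x) := by rw [hK.closure_orbit hx]; exact hvK
    obtain ⟨y, hyV, t, rfl⟩ := mem_closure_iff.1 this V hV hvV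
    exact mem_iUnion.2 ⟨t, hyV⟩
  obtain ⟨T, hT⟩ := hK.isClosed.isCompact.elim_finite_subcover _
    (fun t => hV.preimage (φ.continuous_toFun t)) hcov
  obtain ⟨R, hR⟩ := (T.image fun t => |t|).bddAbove
  refine ⟨R, fun x hx => ?_⟩
  obtain ⟨t, ht, hxt⟩ := mem_iUnion₂.1 (hT hx)
  exact ⟨t, hR (Finset.mem_coe.2 (Finset.mem_image_of_mem _ ht)), hxt⟩

/-- The points moved by `F` along the flow by a time at most `N`. -/
def displacedBy (φ : Flow ℝ M) (F : M → M) (N : ℝ) : Set M := {x | ∃ t, |t| ≤ N ∧ F x = φ t x}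

/-- The set is the projection of a compact subset of [−N, N] × M. Closedness is what Baire's theorem
needs. -/
theorem isClosed_displacedBy [CompactSpace M] [T2Space M] {F : M → M} (hF : Continuous F) (N : ℝ) :
    IsClosed (displacedBy φ F N) := by
  have h1 : IsCompact ((Icc (-N) N ×ˢ univ) ∩ {p : ℝ × M | F p.2 = φ p.1 p.2}) :=
    (isCompact_Icc.prod isCompact_univ).inter_right
      (isClosed_eq (hF.comp continuous_snd) (φ.continuous continuous_fst continuous_snd))
  have h2 : displacedBy φ F N =
      Prod.snd '' ((Icc (-N) N ×ˢ univ) ∩ {p : ℝ × M | F p.2 = φ p.1 p.2}) := by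
    ext x
    constructor
    · rintro ⟨t, ht, h⟩
      exact ⟨(t, x), ⟨⟨abs_le.1 ht, trivial⟩, h⟩, rfl⟩
    · rintro ⟨⟨t, y⟩, ⟨⟨ht, -⟩, h⟩, rfl⟩
      exact ⟨t, abs_le.2 ht, h⟩
  rw [h2]
  exact (h1.image continuous_snd).isClosed

theorem iUnion_displacedBy {F : M → M} (hF : ∀ x, ∃ t, F x = φ t x) :
    ⋃ N : ℕ, displacedBy φ F N = univ := by
  refine eq_univ_of_forall fun x => ?_
  obtain ⟨t, ht⟩ := hF x
  obtain ⟨N, hN⟩ := exists_nat_ge |t|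
  exact mem_iUnion.2 ⟨N, t, hN, ht⟩

theorem abs_clock_le {f : M → ℝ} {C : ℝ} (hC : ∀ x, |f x| ≤ C) (t : ℝ) (x : M) :
    |clock φ f t x| ≤ C * |t| := by
  have := intervalIntegral.norm_integral_le_of_norm_le_const (a := 0) (b := t) (C := C)
    (f := fun s => f (φ s x)) fun s _ => hC _
  simpa [clock] using this

theorem exists_abs_le_of_continuous [CompactSpace M] {f : M → ℝ} (hf : Continuous f) :
    ∃ C, 0 ≤ C ∧ ∀ x, |f x| ≤ C := by
  obtain ⟨C, hC⟩ := (isCompact_range hf.abs).bddAbove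
  exact ⟨max C 0, le_max_right _ _, fun x => (hC (mem_range_self x)).trans (le_max_left _ _)⟩

end MinimalSets

/-! ### The conjugacy constant and uniqueness of the minimal set -/

section LeafConj

variable {n : ℕ} {M : Type*} [TopologicalSpace M] [ChartedSpace (EuclideanSpace ℝ (Fin n)) M]
  {φ : Flow ℝ M} {f₁ f₂ : M → ℝ} {δ₁ δ₂ : ℝ} {F : M → M} {c : ℝ} {K : Set M}

theorem IsLeafConj.exists_apply_flow (hF : IsLeafConj n φ f₁ f₂ F c) (h₂ : IsSpeed n f₂ δ₂)
    (x : M) (t : ℝ) :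
    ∃ θ, clock φ f₂ θ (F x) = c * clock φ f₁ t x ∧ F (φ t x) = φ θ (F x) := by
  have := h₂.clock_unclock (φ := φ) (c * clock φ f₁ t x) (F x)
  exact ⟨_, this, hF.conj _ _ _ this⟩

/-- The displacement of `F` can be chosen to vary along an orbit according to the two clocks. -/
theorem IsLeafConj.exists_displacement (hF : IsLeafConj n φ f₁ f₂ F c) (h₂ : IsSpeed n f₂ δ₂)
    {x : M} {h₀ : ℝ} (hx : F x = φ h₀ x) (t : ℝ) :
    ∃ h, F (φ t x) = φ h (φ t x) ∧
      clock φ f₂ h (φ t x) = clock φ f₂ h₀ x + c * clock φ f₁ t x - clock φ f₂ t x := by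
  obtain ⟨θ, hθ, hF'⟩ := hF.exists_apply_flow h₂ x t
  refine ⟨θ + h₀ - t, ?_, ?_⟩
  · rw [hF', hx, ← φ.map_add, ← φ.map_add]
    congr 1
    ring
  · have h1 := clock_add (φ := φ) h₂.continuous t (θ + h₀ - t) x
    have h2 := clock_add (φ := φ) h₂.continuous h₀ θ x
    rw [← hx, hθ] at h2
    rw [show t + (θ + h₀ - t) = h₀ + θ by ring] at h1
    linarith

/-- Baire's theorem in K bounds the displacement by some N on a relatively open subset, which every
point of K reaches within a uniform time R. Carrying the bound back along the orbit costs only a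
bounded amount. -/
theorem IsLeafConj.exists_bounded_displacement [CompactSpace M] [T2Space M]
    (hF : IsLeafConj n φ f₁ f₂ F c) (h₁ : Continuous f₁)
    (h₂ : IsSpeed n f₂ δ₂) (hK : IsMinimalSet φ K) : ∃ N, K ⊆ displacedBy φ F N := by
  have : CompactSpace K := isCompact_iff_compactSpace.1 hK.isClosed.isCompact
  have : Nonempty K := hK.nonempty.to_subtype
  obtain ⟨N, hN⟩ := nonempty_interior_of_iUnion_of_closed
    (f := fun N : ℕ => ((↑) : K → M) ⁻¹' displacedBy φ F N)
    (fun N => (isClosed_displacedBy hF.smooth.continuous N).preimage continuous_subtype_val)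
    (by rw [← preimage_iUnion, iUnion_displacedBy hF.exists_time, preimage_univ])
  obtain ⟨V, hV, hVeq⟩ := isOpen_induced_iff.1
    (isOpen_interior (s := ((↑) : K → M) ⁻¹' displacedBy φ F N))
  have hVN : ∀ x ∈ K, x ∈ V → x ∈ displacedBy φ F N := by
    intro x hx hxV
    have : (⟨x, hx⟩ : K) ∈ interior (((↑) : K → M) ⁻¹' displacedBy φ F N) := by
      rw [← hVeq]; exact hxV
    exact (interior_subset this : (⟨x, hx⟩ : K) ∈ ((↑) : K → M) ⁻¹' displacedBy φ F N)
  obtain ⟨R, hR⟩ := hK.exists_time_mem_open hV (by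
    obtain ⟨x, hx⟩ := hN
    rw [← hVeq] at hx
    exact ⟨x, hx, x.2⟩)
  obtain ⟨C, hC0, hC⟩ := exists_abs_le_of_continuous h₁
  -- Going back from φ^s x, the displacement of x is θ + t + s: s is the hitting time, t the
  -- displacement at φ^s x, and θ the time by which F(φ^s x) is moved to F x. The clock relation and
  -- f₂ ≥ δ₂ bound θ by the first summand.
  refine ⟨c * (C * R) / δ₂ + N + R, fun x hx => ?_⟩
  obtain ⟨s, hs, hsV⟩ := hR x hx
  obtain ⟨t, ht, hFt⟩ := hVN _ (hK.invariant s x hx) hsV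
  obtain ⟨θ, hθ, hFθ⟩ := hF.exists_apply_flow h₂ (φ s x) (-s)
  have hxs : φ (-s) (φ s x) = x := by rw [← φ.map_add]; simp
  refine ⟨θ + t + s, ?_, ?_⟩
  · have h3 : |θ| ≤ c * (C * R) / δ₂ := by
      rw [le_div_iff₀ h₂.pos, mul_comm]
      have h4 := mul_abs_sub_le_abs_clock_sub (φ := φ) h₂.continuous h₂.le 0 θ (F (φ s x))
      simp only [sub_zero, clock_zero] at h4
      refine h4.trans ?_
      rw [hθ, abs_mul, abs_of_pos hF.pos]
      refine mul_le_mul_of_nonneg_left ?_ hF.pos.le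
      refine (abs_clock_le hC _ _).trans ?_
      rw [abs_neg]
      exact mul_le_mul_of_nonneg_left hs hC0
    calc |θ + t + s| ≤ |θ| + |t| + |s| := abs_add_three _ _ _
      _ ≤ _ := by gcongr
  · rw [hxs] at hFθ
    rw [hFθ, hFt, ← φ.map_add, ← φ.map_add]

/-- If the speeds are constant on a minimal set, then their ratio is the conjugacy constant. -/
theorem IsLeafConj.mul_eq_of_const [CompactSpace M] [T2Space M] (hφ : IsSmoothLocallyFree n φ)
    (hF : IsLeafConj n φ f₁ f₂ F c) (h₁ : IsSpeed n f₁ δ₁) (h₂ : IsSpeed n f₂ δ₂)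
    (hK : IsMinimalSet φ K) {a₁ a₂ : ℝ} (ha₁ : ∀ x ∈ K, f₁ x = a₁) (ha₂ : ∀ x ∈ K, f₂ x = a₂) :
    c * a₁ = a₂ := by
  obtain ⟨x, hx⟩ := hK.nonempty
  have p₁ : 0 < a₁ := ha₁ x hx ▸ h₁.pos.trans_le (h₁.le x)
  have p₂ : 0 < a₂ := ha₂ x hx ▸ h₂.pos.trans_le (h₂.le x)
  set b := c * a₁ / a₂ with hb
  have hb0 : 0 < b := div_pos (mul_pos hF.pos p₁) p₂
  suffices b = 1 by
    rw [hb, div_eq_one_iff_eq p₂.ne'] at this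
    exact this
  have hFK : ∀ y ∈ K, F y ∈ K := by
    intro y hy
    obtain ⟨t, ht⟩ := hF.exists_time y
    rw [ht]
    exact hK.invariant t y hy
  -- With constant speeds both clocks are linear, so F rescales time by b along the orbit.
  have hFb : ∀ t, F (φ t x) = φ (b * t) (F x) := by
    intro t
    refine hF.conj _ _ _ ?_
    rw [clock_eq_mul_of_orbit (a := a₂), clock_eq_mul_of_orbit (a := a₁), hb]
    · field_simp
    · exact fun t => ha₁ _ (hK.invariant t _ hx)
    · exact fun t => ha₂ _ (hK.invariant t _ (hFK _ hx))
  obtain ⟨h₀, hh₀⟩ := hF.exists_time x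
  -- On a free orbit the displacement at φ^t x is exactly (b − 1)t + h₀, and boundedness forces b =
  -- 1. On a periodic orbit, multiplication by b preserves the set of periods in both directions, so
  -- b ≠ 1 would make nonzero periods accumulate at 0.
  by_cases hfree : ∀ t, φ t x = x → t = 0
  · obtain ⟨N, hN⟩ := hF.exists_bounded_displacement h₁.continuous h₂ hK
    have hbd : ∀ t, |(b - 1) * t + h₀| ≤ N := by
      intro t
      obtain ⟨s, hs, hFs⟩ := hN (hK.invariant t x hx)
      have h3 : φ (b * t + h₀ - (s + t)) x = x := by
        have h4 : φ (b * t + h₀) x = φ (s + t) x := by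
          rw [φ.map_add, ← hh₀, ← hFb, hFs, ← φ.map_add]
        rw [sub_eq_neg_add, φ.map_add, h4, ← φ.map_add, neg_add_cancel, φ.map_zero_apply]
      have h5 := hfree _ h3
      rwa [show (b - 1) * t + h₀ = s by linarith]
    by_contra hb1
    have hb1' : b - 1 ≠ 0 := sub_ne_zero.2 hb1
    have h6 := hbd ((N + 1 - h₀) / (b - 1))
    rw [mul_div_cancel₀ _ hb1'] at h6
    have := (le_abs_self _).trans h6
    linarith
  · push Not at hfree
    obtain ⟨p, hp, hp0⟩ := hfree
    have comm : ∀ s t y, φ s (φ t y) = φ t (φ s y) := fun s t y => by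
      rw [← φ.map_add, ← φ.map_add, add_comm]
    have hcancel : ∀ s y z, φ s y = φ s z → y = z := fun s y z h =>
      (φ.toHomeomorph s).injective h
    have hS : ∀ t, φ t x = x ↔ φ (b * t) x = x := by
      intro t
      have h7 := hFb t
      constructor
      · intro h
        rw [h, hh₀, comm] at h7
        exact (hcancel _ _ _ h7).symm
      · intro h
        rw [hh₀, comm, h, ← hh₀] at h7
        exact hF.injective h7
    have hpow : ∀ k : ℕ, φ (b ^ k * p) x = x := by
      intro k
      induction k with
      | zero => simpa using hp
      | succ k ih =>
        rw [pow_succ', mul_assoc]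
        exact (hS _).1 ih
    have hpow' : ∀ k : ℕ, φ (b⁻¹ ^ k * p) x = x := by
      intro k
      induction k with
      | zero => simpa using hp
      | succ k ih =>
        rw [hS, pow_succ', mul_assoc, mul_inv_cancel_left₀ hb0.ne']
        exact ih
    have key : ∀ r : ℝ, 0 < r → r < 1 → ¬ ∀ k : ℕ, φ (r ^ k * p) x = x := by
      intro r hr0 hr1 h
      have h8 : Tendsto (fun k : ℕ => r ^ k * p) atTop (𝓝[≠] 0) := by
        refine tendsto_nhdsWithin_iff.2 ⟨?_, Eventually.of_forall fun k => ?_⟩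
        · simpa using (tendsto_pow_atTop_nhds_zero_of_lt_one hr0.le hr1).mul_const p
        · exact mul_ne_zero (pow_ne_zero _ hr0.ne') hp0
      obtain ⟨k, hk⟩ := (h8.eventually (hφ.locallyFree x)).exists
      exact hk (h k)
    rcases lt_trichotomy b 1 with h | h | h
    · exact (key b hb0 h hpow).elim
    · exact h
    · exact (key b⁻¹ (inv_pos.2 hb0) (inv_lt_one_of_one_lt₀ h) hpow').elim

variable [IsManifold (𝓡 n) ∞ M] [CompactSpace M] [T2Space M]

/-- Distinct minimal sets are disjoint. For a smooth `g` equal to 0 on one and 1 on the other, the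
first gives c = 1 and the second c(1 + l₁) = 1 + l₂, contradicting l₁ ≠ l₂. -/
theorem isMinimalSet_unique (hφ : IsSmoothLocallyFree n φ) (hr : IsParameterRigid n φ)
    {K₁ K₂ : Set M} (hK₁ : IsMinimalSet φ K₁) (hK₂ : IsMinimalSet φ K₂) : K₁ = K₂ := by
  by_cases hd : (K₁ ∩ K₂).Nonempty
  · have hinv : ∀ t, ∀ x ∈ K₁ ∩ K₂, φ t x ∈ K₁ ∩ K₂ := fun t x hx =>
      ⟨hK₁.invariant t x hx.1, hK₂.invariant t x hx.2⟩
    have hcl := hK₁.isClosed.inter hK₂.isClosed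
    rw [← hK₁.eq_of_subset _ inter_subset_left hcl hd hinv]
    exact hK₂.eq_of_subset _ inter_subset_right hcl hd hinv
  · obtain ⟨g, hg, hgr, hg0, hg1⟩ := exists_contMDiff_zero_iff_one_iff_of_isClosed (n := ⊤) (𝓡 n)
      hK₁.isClosed hK₂.isClosed (disjoint_iff_inter_eq_empty.2 (not_nonempty_iff_eq_empty.1 hd))
    have hgnn : ∀ x, 0 ≤ g x := fun x => (hgr (mem_range_self x)).1
    obtain ⟨l₁, l₂, F, c, p₁, p₂, -, -, hne, hF⟩ := hr.exists_isLeafConj hφ hg hgnn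
    have e1 := hF.mul_eq_of_const hφ (isSpeed_one_add_mul hg hgnn p₁)
      (isSpeed_one_add_mul hg hgnn p₂) hK₁ (a₁ := 1) (a₂ := 1)
      (fun x hx => by simp [(hg0 x).1 hx]) (fun x hx => by simp [(hg0 x).1 hx])
    have e2 := hF.mul_eq_of_const hφ (isSpeed_one_add_mul hg hgnn p₁)
      (isSpeed_one_add_mul hg hgnn p₂) hK₂ (a₁ := 1 + l₁) (a₂ := 1 + l₂)
      (fun x hx => by simp [(hg1 x).1 hx]) (fun x hx => by simp [(hg1 x).1 hx])
    rw [mul_one] at e1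
    rw [e1, one_mul] at e2
    exact (hne (by linarith)).elim

end LeafConj

/-- A function vanishing at `0` that is bounded by `B` wherever its derivative is nonzero is bounded
by `B`. -/
theorem abs_le_of_abs_le_of_deriv_ne_zero {G g : ℝ → ℝ} (hG : ∀ t, HasDerivAt G (g t) t)
    (h0 : G 0 = 0) {B : ℝ} (hb : ∀ t, g t ≠ 0 → |G t| ≤ B) (hB : 0 ≤ B) (t : ℝ) : |G t| ≤ B := by
  -- Φ is smooth, nonnegative, and zero exactly where |G| ≤ B. Its derivative vanishes everywhere:
  -- by the chain rule where g = 0, and because Φ is at its minimum 0 elsewhere.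
  let Φ : ℝ → ℝ := fun t => expNegInvGlue (G t ^ 2 - B ^ 2)
  have hΦ : ∀ t, HasDerivAt Φ (deriv expNegInvGlue (G t ^ 2 - B ^ 2) * (2 * G t * g t)) t := by
    intro t
    have h1 : HasDerivAt (fun t => G t ^ 2 - B ^ 2) (2 * G t * g t) t := by
      simpa using! ((hG t).pow 2).sub_const (B ^ 2)
    have h2 : HasDerivAt expNegInvGlue (deriv expNegInvGlue (G t ^ 2 - B ^ 2)) (G t ^ 2 - B ^ 2) :=
      ((expNegInvGlue.contDiff (n := 1)).differentiable (by simp) _).hasDerivAt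
    exact h2.comp t h1
  have hd : ∀ t, deriv Φ t = 0 := by
    intro t
    by_cases hg : g t = 0
    · rw [(hΦ t).deriv, hg]
      simp
    · have h3 : Φ t = 0 := by
        refine expNegInvGlue.zero_of_nonpos ?_
        have := sq_le_sq' (abs_le.1 (hb t hg)).1 (abs_le.1 (hb t hg)).2
        linarith
      have h4 : IsLocalMin Φ t := Eventually.of_forall fun s => by
        rw [h3]; exact expNegInvGlue.nonneg _
      exact h4.deriv_eq_zero
  have hc : Φ t = Φ 0 := is_const_of_deriv_eq_zero (fun t => (hΦ t).differentiableAt) hd t 0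
  have h5 : Φ 0 = 0 := by
    refine expNegInvGlue.zero_of_nonpos ?_
    rw [h0]
    nlinarith
  rw [h5] at hc
  have h6 := expNegInvGlue.zero_iff_nonpos.1 hc
  exact abs_le_of_sq_le_sq (by linarith) hB

/-! ### Minimality of a rigid flow -/

section Minimality

variable {n : ℕ} {M : Type*} [TopologicalSpace M] [ChartedSpace (EuclideanSpace ℝ (Fin n)) M]
  [IsManifold (𝓡 n) ∞ M] [CompactSpace M] [T2Space M]
  {φ : Flow ℝ M} {f₁ f₂ : M → ℝ} {F : M → M} {K : Set M}

/-- Translation invariance of `l` makes the limit set of the orbit along `l` invariant, so it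
contains a minimal set, which can only be K. It serves for `atTop` and `atBot`. -/
theorem exists_mem_mapClusterPt (hK : ∀ K', IsMinimalSet φ K' → K' = K) (x : M) (l : Filter ℝ)
    [l.NeBot] (hl : ∀ t, Tendsto (t + ·) l l) : ∃ k ∈ K, MapClusterPt k l fun t => φ t x := by
  obtain ⟨K', hK'ω, hK'⟩ := exists_isMinimalSet_subset (φ := φ) (isClosed_omegaLimit l φ.toFun {x})
    (nonempty_omegaLimit l φ.toFun {x} (singleton_nonempty x))
    (fun t y hy => Flow.isInvariant_omegaLimit (f := l) (ϕ := φ) (s := {x}) hl t hy)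
  obtain ⟨k, hk⟩ := hK'.nonempty
  exact ⟨k, hK K' hK' ▸ hk, (mem_omegaLimit_singleton_iff_mapClusterPt _ _ _ _).1 (hK'ω hk)⟩

/-- If the displacement along an orbit converges, then `F` is a time of the flow on the minimal
set. -/
theorem IsLeafConj.eq_flow_on_of_tendsto (hφ : IsSmoothLocallyFree n φ)
    (hF : IsLeafConj n φ f₁ f₂ F 1) (h₂ : IsSpeed n f₂ 1)
    (hK : IsMinimalSet φ K) (hu : ∀ K', IsMinimalSet φ K' → K' = K)
    (ha₁ : ∀ x ∈ K, f₁ x = 1) (ha₂ : ∀ x ∈ K, f₂ x = 1) {x : M} {h₀ : ℝ} (hx : F x = φ h₀ x)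
    (l : Filter ℝ) [l.NeBot] (hl : ∀ t, Tendsto (t + ·) l l) {H : ℝ}
    (hlim : Tendsto (fun t => clock φ f₂ h₀ x + clock φ f₁ t x - clock φ f₂ t x) l (𝓝 H)) :
    ∀ k ∈ K, F k = φ H k := by
  obtain ⟨k, hkK, hk⟩ := exists_mem_mapClusterPt hu x l hl
  obtain ⟨U, hUl, hU⟩ := mapClusterPt_iff_ultrafilter.1 hk
  choose h hFh hclk using hF.exists_displacement h₂ hx
  simp only [one_mul] at hclk
  have hlimU := hlim.mono_left hUl
  -- Because f₂ ≥ 1, a displacement is no longer than its clock, and the clock converges.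
  have hbdd : ∀ᶠ t in (U : Filter ℝ), h t ∈ Icc (-(|H| + 1)) (|H| + 1) := by
    have h1 := hlimU.abs.eventually (gt_mem_nhds (lt_add_one |H|))
    filter_upwards [h1] with t ht
    have h2 := mul_abs_sub_le_abs_clock_sub (φ := φ) h₂.continuous h₂.le 0 (h t) (φ t x)
    rw [hclk, clock_zero, sub_zero, sub_zero, one_mul] at h2
    exact abs_le.1 (h2.trans ht.le)
  obtain ⟨h', -, hh'⟩ := isCompact_Icc.ultrafilter_le_nhds (U.map h)
    (le_principal_iff.2 hbdd)
  replace hh' : Tendsto h U (𝓝 h') := hh'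
  have hprod : Tendsto (fun t => (h t, φ t x)) U (𝓝 (h', k)) := hh'.prodMk_nhds hU
  have e1 : F k = φ h' k := by
    have h3 : Tendsto (fun t => F (φ t x)) U (𝓝 (F k)) := (hF.smooth.continuous.tendsto k).comp hU
    have h4 : Tendsto (fun t => φ (h t) (φ t x)) U (𝓝 (φ h' k)) :=
      (φ.cont'.tendsto (h', k)).comp hprod
    refine tendsto_nhds_unique h3 (h4.congr fun t => (hFh t).symm)
  -- At k ∈ K the speed f₂ is 1 along the whole orbit, so the clock of the limiting displacement h'
  -- is h' itself.
  have e2 : H = h' := by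
    have h5 : Tendsto (fun t => clock φ f₂ (h t) (φ t x)) U (𝓝 (clock φ f₂ h' k)) :=
      ((contMDiff_clock hφ h₂.smooth).continuous.tendsto (h', k)).comp hprod
    rw [clock_eq_mul_of_orbit (a := 1) (fun t => ha₂ _ (hK.invariant t k hkK)), one_mul] at h5
    exact tendsto_nhds_unique (hlimU.congr fun t => (hclk t).symm) h5
  subst e2
  have hcl : IsClosed {y | F y = φ H y} :=
    isClosed_eq hF.smooth.continuous (φ.continuous_toFun H)
  have hFk : F k ∈ K := by rw [e1]; exact hK.invariant _ _ hkK
  -- On K both speeds are 1 and c = 1, so F commutes with the flow there; the identity at k spreads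
  -- over its orbit, which is dense in K.
  have horb : φ.orbit k ⊆ {y | F y = φ H y} := by
    rintro y ⟨t, rfl⟩
    change F (φ t k) = φ H (φ t k)
    rw [hF.conj k t t, e1, ← φ.map_add, ← φ.map_add, add_comm]
    rw [clock_eq_mul_of_orbit (a := 1) (fun t => ha₂ _ (hK.invariant t _ hFk)),
      clock_eq_mul_of_orbit (a := 1) (fun t => ha₁ _ (hK.invariant t k hkK)), one_mul, one_mul]
  intro y hy
  rw [← hK.closure_orbit hkK] at hy
  exact closure_minimal horb hcl hy

/-- A periodic orbit is compact and invariant, hence contains the unique minimal set K, and then the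
orbit lies in K. -/
theorem eq_zero_of_periodic_of_notMem (hu : ∀ K', IsMinimalSet φ K' → K' = K)
    (hKinv : ∀ t, ∀ x ∈ K, φ t x ∈ K) {x : M} (hx : x ∉ K)
    {p : ℝ} (hp : φ p x = x) : p = 0 := by
  by_contra hp0
  have hper : Function.Periodic (fun t => φ t x) p := fun t => by
    simp only
    rw [φ.map_add, hp]
  have hcomp : IsCompact (φ.orbit x) := by
    rw [φ.orbit_eq_range]
    rw [← hper.image_uIcc hp0 0]
    exact isCompact_uIcc.image (continuous_orbitMap φ x)
  obtain ⟨K', hK'o, hK'⟩ := exists_isMinimalSet_subset (φ := φ) hcomp.isClosed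
    (φ.nonempty_orbit x) (apply_mem_orbit x)
  rw [hu K' hK'] at hK'o hK'
  obtain ⟨k, hk⟩ := hK'.nonempty
  obtain ⟨t, rfl⟩ := hK'o hk
  refine hx ?_
  have := hKinv (-t) _ hk
  change φ (-t) (φ t x) ∈ K at this
  rwa [← φ.map_add, neg_add_cancel, φ.map_zero_apply] at this

/-- Off the minimal set there is a point whose orbit spends a finite amount of time near it. -/
theorem exists_bump_bounded_clock (hφ : IsSmoothLocallyFree n φ) (hr : IsParameterRigid n φ)
    (hK : IsMinimalSet φ K) (hne : K ≠ univ) :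
    ∃ (x : M) (g : M → ℝ) (B : ℝ), ContMDiff (𝓡 n) 𝓘(ℝ, ℝ) ∞ g ∧ (∀ y, 0 ≤ g y) ∧
      (∀ y ∈ K, g y = 0) ∧ 0 < g x ∧ ∀ t, |clock φ g t x| ≤ B := by
  have hu : ∀ K', IsMinimalSet φ K' → K' = K := fun K' hK' => isMinimalSet_unique hφ hr hK' hK
  obtain ⟨g, hg, hgr, hg0, -⟩ := exists_contMDiff_zero_iff_one_iff_of_isClosed (n := ⊤) (𝓡 n)
    hK.isClosed isClosed_empty (disjoint_empty K)
  have hgnn : ∀ x, 0 ≤ g x := fun x => (hgr (mem_range_self x)).1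
  have hgle : ∀ x, g x ≤ 1 := fun x => (hgr (mem_range_self x)).2
  obtain ⟨l₁, l₂, F, c, p₁, p₂, -, q₂, hl, hF⟩ := hr.exists_isLeafConj hφ hg hgnn
  have s₂ := isSpeed_one_add_mul hg hgnn p₂
  have hc := hF.mul_eq_of_const hφ (isSpeed_one_add_mul hg hgnn p₁) s₂ hK (a₁ := 1) (a₂ := 1)
    (fun x hx => by simp [(hg0 x).1 hx]) (fun x hx => by simp [(hg0 x).1 hx])
  rw [mul_one] at hc
  subst hc
  -- Baire's theorem on M yields an open set off K on which the displacement is at most N; W is a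
  -- closed neighbourhood of x inside it.
  have hdense := dense_iUnion_interior_of_closed (f := fun N : ℕ => displacedBy φ F N)
    (fun N => isClosed_displacedBy hF.smooth.continuous N) (iUnion_displacedBy hF.exists_time)
  obtain ⟨x, hxK, hxI⟩ := hdense.inter_open_nonempty Kᶜ hK.isClosed.isOpen_compl
    (nonempty_compl.2 hne)
  obtain ⟨N, hxN⟩ := mem_iUnion.1 hxI
  obtain ⟨W, hW, hWc, hWV⟩ := exists_mem_nhds_isClosed_subset
    ((hK.isClosed.isOpen_compl.inter isOpen_interior).mem_nhds ⟨hxK, hxN⟩)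
  obtain ⟨g', hgs, hg', hg'0⟩ := (isOpen_interior (s := W)).exists_contMDiff_support_eq
    (n := ⊤) (𝓡 n)
  obtain ⟨C, hC0, hC⟩ := exists_abs_le_of_continuous hg'.continuous
  have hgW : ∀ y ∈ W, g y ≠ 0 := fun y hy h => (hWV hy).1 ((hg0 y).2 h)
  obtain ⟨y₀, hy₀, hmin⟩ := hWc.isCompact.exists_isMinOn ⟨x, mem_of_mem_nhds hW⟩
    hg.continuous.continuousOn
  have hd : 0 < g y₀ := (hgnn y₀).lt_of_ne' (hgW y₀ hy₀)
  have hsup : ∀ y, g' y ≠ 0 → y ∈ W := fun y hy => interior_subset (hgs ▸ hy)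
  have hgg' : ∀ y, g' y ≤ C / g y₀ * g y := by
    intro y
    by_cases hy : g' y = 0
    · rw [hy]
      exact mul_nonneg (div_nonneg hC0 hd.le) (hgnn y)
    · calc g' y ≤ C := (le_abs_self _).trans (hC y)
        _ = C / g y₀ * g y₀ := by field_simp
        _ ≤ _ := mul_le_mul_of_nonneg_left (hmin (hsup y hy)) (div_nonneg hC0 hd.le)
  have hfree : ∀ t, φ t x = x → t = 0 := fun t ht =>
    eq_zero_of_periodic_of_notMem hu hK.invariant hxK ht
  obtain ⟨h₀, hh₀, hFx⟩ := interior_subset hxN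
  have hf2 : ∀ y, |1 + l₂ * g y| ≤ 3 := by
    intro y
    have h1 := mul_nonneg p₂ (hgnn y)
    have h2 : l₂ * g y ≤ 2 * 1 := mul_le_mul q₂ (hgle y) (hgnn y) zero_le_two
    rw [abs_of_nonneg (by linarith)]
    linarith
  -- When the orbit of x is in W, both end displacements are at most N, and freeness identifies them
  -- with those of `exists_displacement`. Since f₂ ≤ 3, their clocks are at most 3N each, and they
  -- differ by (l₁ − l₂)∫g.
  have hret : ∀ t, φ t x ∈ W → |clock φ g t x| ≤ 6 * N / |l₁ - l₂| := by
    intro t ht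
    obtain ⟨h, hhN, hFh⟩ := interior_subset (hWV ht).2
    obtain ⟨h', hFh', hclk⟩ := hF.exists_displacement s₂ hFx t
    have e : h' = h := by
      have e1 : φ (h' + t) x = φ (h + t) x := by
        rw [φ.map_add, φ.map_add, ← hFh, hFh']
      have e2 : φ (-(h + t) + (h' + t)) x = x := by
        rw [φ.map_add, e1, ← φ.map_add, neg_add_cancel, φ.map_zero_apply]
      linarith [hfree _ e2]
    subst e
    have b1 := abs_clock_le (φ := φ) hf2 h' (φ t x)
    have b2 := abs_clock_le (φ := φ) hf2 h₀ x
    rw [clock_one_add_mul hg.continuous l₁ t x, clock_one_add_mul hg.continuous l₂ t x] at hclk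
    have e3 : (l₁ - l₂) * clock φ g t x = clock φ (fun x => 1 + l₂ * g x) h' (φ t x) -
        clock φ (fun x => 1 + l₂ * g x) h₀ x := by linarith
    rw [le_div_iff₀ (abs_pos.2 (sub_ne_zero.2 hl)), mul_comm, ← abs_mul, e3]
    refine (abs_sub _ _).trans ?_
    linarith
  have hcomp : ∀ t, |clock φ g' t x| ≤ C / g y₀ * |clock φ g t x| := by
    intro t
    have m1 := clock_mono_of_nonneg (φ := φ) hg'.continuous hg'0 x
    have m3 := clock_mono_of_nonneg (φ := φ) (f := fun y => C / g y₀ * g y + (-1) * g' y)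
      (by have := hg.continuous; have := hg'.continuous; fun_prop)
      (fun y => by linarith [hgg' y]) x
    have e4 := clock_sub_fun (φ := φ) hg.continuous hg'.continuous (C / g y₀) (-1) t x
    have hC' : 0 ≤ C / g y₀ := div_nonneg hC0 hd.le
    rcases le_total 0 t with ht | ht
    · have n1 := m1 ht
      have n3 := m3 ht
      simp only [clock_zero] at n1 n3
      rw [e4] at n3
      rw [abs_of_nonneg n1]
      have := mul_le_mul_of_nonneg_left (le_abs_self (clock φ g t x)) hC'
      linarith
    · have n1 := m1 ht
      have n3 := m3 ht
      simp only [clock_zero] at n1 n3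
      rw [e4] at n3
      rw [abs_of_nonpos n1]
      have := mul_le_mul_of_nonneg_left (neg_le_abs (clock φ g t x)) hC'
      linarith
  have hB0 : 0 ≤ C / g y₀ * (6 * N / |l₁ - l₂|) := by positivity
  refine ⟨x, g', C / g y₀ * (6 * N / |l₁ - l₂|), hg', hg'0, ?_, ?_, ?_⟩
  · intro y hy
    by_contra h
    exact (hWV (hsup y h)).1 hy
  · refine (hg'0 x).lt_of_ne' ?_
    have : x ∈ Function.support g' := by rw [hgs]; exact mem_interior_iff_mem_nhds.2 hW
    exact this
  -- The clock of g' only moves while the orbit is in W, where it is already bounded.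
  · refine abs_le_of_abs_le_of_deriv_ne_zero (fun t => hasDerivAt_clock hg'.continuous t x)
      (clock_zero x) (fun t ht => ?_) hB0
    exact (hcomp t).trans (mul_le_mul_of_nonneg_left (hret t (hsup _ ht)) (by positivity))

/-- A parameter rigid flow is minimal. -/
theorem IsMinimalSet.eq_univ_of_rigid (hφ : IsSmoothLocallyFree n φ) (hr : IsParameterRigid n φ)
    (hK : IsMinimalSet φ K) : K = univ := by
  by_contra hne
  have hu : ∀ K', IsMinimalSet φ K' → K' = K := fun K' hK' => isMinimalSet_unique hφ hr hK' hK
  obtain ⟨x, g, B, hg, hg0, hgK, hgx, hB⟩ := exists_bump_bounded_clock hφ hr hK hne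
  have hmono := clock_mono_of_nonneg (φ := φ) hg.continuous hg0 x
  set G : ℝ → ℝ := fun t => clock φ g t x with hG
  have hbdd : ∀ t, G t ≤ B ∧ -B ≤ G t := fun t => ⟨(abs_le.1 (hB t)).2, (abs_le.1 (hB t)).1⟩
  have ha : BddAbove (range G) := ⟨B, by rintro _ ⟨t, rfl⟩; exact (hbdd t).1⟩
  have hb : BddBelow (range G) := ⟨-B, by rintro _ ⟨t, rfl⟩; exact (hbdd t).2⟩
  have htop := tendsto_atTop_ciSup hmono ha
  have hbot := tendsto_atBot_ciInf hmono hb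
  set Lp := ⨆ t, G t
  set Lm := ⨅ t, G t
  -- G is not constant, since its derivative at 0 is g x > 0.
  have hlt : Lm < Lp := by
    have h1 : Lm ≤ G 0 := ciInf_le hb 0
    have h2 : ∃ t, G 0 < G t := by
      by_contra! hcon
      have h3 : IsLocalMax G 0 := Eventually.of_forall hcon
      have h4 := h3.hasDerivAt_eq_zero (hasDerivAt_clock (φ := φ) hg.continuous 0 x)
      rw [φ.map_zero_apply] at h4
      exact hgx.ne' h4
    obtain ⟨t, ht⟩ := h2
    exact h1.trans_lt (ht.trans_le (le_ciSup ha t))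
  obtain ⟨k, hk⟩ := hK.nonempty
  obtain ⟨η, hη, hηk⟩ : ∃ η > 0, ∀ s, s ≠ 0 → |s| < η → φ s k ≠ k := by
    have := hφ.locallyFree k
    rw [eventually_nhdsWithin_iff, Metric.eventually_nhds_iff] at this
    obtain ⟨η, hη, h⟩ := this
    exact ⟨η, hη, fun s hs hs' => h (by simpa using hs') hs⟩
  -- As |l₁ − l₂| ≤ 2, the final candidate period (l₁ − l₂)ε(Lp − Lm) has size at most 2η/3, below
  -- the threshold η for periods of k.
  set ε := η / (3 * (Lp - Lm)) with hε
  have hd : 0 < Lp - Lm := sub_pos.2 hlt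
  have hε0 : 0 < ε := by positivity
  have hg' : ContMDiff (𝓡 n) 𝓘(ℝ, ℝ) ∞ fun y => ε * g y := contMDiff_const.mul hg
  have hg'0 : ∀ y, 0 ≤ ε * g y := fun y => mul_nonneg hε0.le (hg0 y)
  obtain ⟨l₁, l₂, F, c, p₁, p₂, q₁, q₂, hl, hF⟩ := hr.exists_isLeafConj hφ hg' hg'0
  have s₂ := isSpeed_one_add_mul hg' hg'0 p₂
  have a₁ : ∀ y ∈ K, 1 + l₁ * (ε * g y) = 1 := fun y hy => by simp [hgK y hy]
  have a₂ : ∀ y ∈ K, 1 + l₂ * (ε * g y) = 1 := fun y hy => by simp [hgK y hy]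
  have hc := hF.mul_eq_of_const hφ (isSpeed_one_add_mul hg' hg'0 p₁) s₂ hK a₁ a₂
  rw [mul_one] at hc
  subst hc
  obtain ⟨h₀, hFx⟩ := hF.exists_time x
  set A := clock φ (fun y => 1 + l₂ * (ε * g y)) h₀ x with hA
  have hE : ∀ t, A + clock φ (fun y => 1 + l₁ * (ε * g y)) t x -
      clock φ (fun y => 1 + l₂ * (ε * g y)) t x = A + (l₁ - l₂) * ε * G t := by
    intro t
    have e : ∀ l, (fun y => 1 + l * (ε * g y)) = fun y => 1 + (l * ε) * g y := fun l => by
      ext y; ring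
    rw [e, e, clock_one_add_mul hg.continuous, clock_one_add_mul hg.continuous]
    ring
  have t1 := hF.eq_flow_on_of_tendsto hφ s₂ hK hu a₁ a₂ hFx atTop
    (fun t => tendsto_atTop_add_const_left _ t tendsto_id)
    (((htop.const_mul ((l₁ - l₂) * ε)).const_add A).congr fun t => (hE t).symm) k hk
  have t2 := hF.eq_flow_on_of_tendsto hφ s₂ hK hu a₁ a₂ hFx atBot
    (fun t => tendsto_atBot_add_const_left _ t tendsto_id)
    (((hbot.const_mul ((l₁ - l₂) * ε)).const_add A).congr fun t => (hE t).symm) k hk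
  refine hηk ((l₁ - l₂) * ε * (Lp - Lm))
    (mul_ne_zero (mul_ne_zero (sub_ne_zero.2 hl) hε0.ne') hd.ne') ?_ ?_
  · rw [abs_mul, abs_mul, abs_of_pos hε0, abs_of_pos hd]
    have h5 : |l₁ - l₂| ≤ 2 := abs_le.2 ⟨by linarith, by linarith⟩
    have h6 : ε * (Lp - Lm) = η / 3 := by rw [hε]; field_simp
    rw [mul_assoc, h6]
    nlinarith
  · have h7 : (l₁ - l₂) * ε * (Lp - Lm) =
        -(A + (l₁ - l₂) * ε * Lm) + (A + (l₁ - l₂) * ε * Lp) := by ring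
    rw [h7, φ.map_add, ← t1, t2, ← φ.map_add, neg_add_cancel, φ.map_zero_apply]

theorem isMinimalSet_univ [Nonempty M] (hφ : IsSmoothLocallyFree n φ)
    (hr : IsParameterRigid n φ) : IsMinimalSet φ (univ : Set M) := by
  obtain ⟨K, -, hK⟩ := exists_isMinimalSet_subset (φ := φ) isClosed_univ univ_nonempty
    (fun _ _ _ => mem_univ _)
  rwa [← hK.eq_univ_of_rigid hφ hr]

end Minimality

/-- A bounded selection from a closed relation is continuous where it is uniquely determined. -/
theorem continuousAt_of_isClosed_of_unique {X : Type*} [TopologicalSpace X] {R : Set (X × ℝ)}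
    (hR : IsClosed R) {h : X → ℝ} (hh : ∀ y, (y, h y) ∈ R) {a N : ℝ} (hN : ∀ y, |h y - a| ≤ N)
    {x : X} (hu : ∀ t, |t - a| ≤ N → (x, t) ∈ R → t = h x) : ContinuousAt h x := by
  rw [ContinuousAt, tendsto_iff_ultrafilter]
  intro U hU
  have hmem : ∀ y, h y ∈ Metric.closedBall a N := fun y => by
    rw [Metric.mem_closedBall, Real.dist_eq]; exact hN y
  obtain ⟨t, ht, hUt⟩ := (isCompact_closedBall a N).ultrafilter_le_nhds (U.map h)
    (le_principal_iff.2 (show ∀ᶠ y in (U : Filter X), h y ∈ _ from Eventually.of_forall hmem))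
  replace hUt : Tendsto h U (𝓝 t) := hUt
  have h1 : Tendsto (fun y => (y, h y)) U (𝓝 (x, t)) := Tendsto.prodMk_nhds hU hUt
  have h2 : (x, t) ∈ R := hR.mem_of_tendsto h1 (Eventually.of_forall hh)
  rw [Metric.mem_closedBall, Real.dist_eq] at ht
  rwa [← hu t ht h2]

/-! ### The cohomological equation along the flow -/

section Cohomology

variable {n : ℕ} {M : Type*} [TopologicalSpace M] [ChartedSpace (EuclideanSpace ℝ (Fin n)) M]
  [IsManifold (𝓡 n) ∞ M] {φ : Flow ℝ M} {f g : M → ℝ}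

/-- `g` is cohomologous to a constant along the flow. -/
def IsCohomologousToConst (n : ℕ) {M : Type*} [TopologicalSpace M]
    [ChartedSpace (EuclideanSpace ℝ (Fin n)) M] (φ : Flow ℝ M) (g : M → ℝ) : Prop :=
  ∃ (u : M → ℝ) (c : ℝ), ContMDiff (𝓡 n) 𝓘(ℝ, ℝ) ∞ u ∧
    ∀ t x, clock φ g t x = u (φ t x) - u x + c * t

theorem hasDerivAt_comp_flow_of_zero {q : M → ℝ} {d a : ℝ} {x : M}
    (h : HasDerivAt (fun t => q (φ t (φ a x))) d 0) : HasDerivAt (fun t => q (φ t x)) d a := by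
  rw [← sub_self a] at h
  have h1 := HasDerivAt.comp_sub_const a a h
  refine h1.congr_of_eventuallyEq (Eventually.of_forall fun t => ?_)
  simp only
  rw [← φ.map_add, sub_add_cancel]

/-- Composing with a function transverse to the flow at F x turns the equation for h into a scalar
one, nondegenerate in time. -/
theorem contMDiffAt_of_flow_eq (hφ : IsSmoothLocallyFree n φ) {F G : M → M} {h : M → ℝ} {x : M}
    (hF : ContMDiff (𝓡 n) (𝓡 n) ∞ F) (hG : ContMDiff (𝓡 n) (𝓡 n) ∞ G)
    (hh : ∀ y, F y = φ (h y) (G y)) (hc : ContinuousAt h x) :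
    ContMDiffAt (𝓡 n) 𝓘(ℝ, ℝ) ∞ h x := by
  obtain ⟨q, d, hq, hd0, hd⟩ := hφ.exists_transverse_function (F x)
  refine contMDiffAt_of_implicit (I := 𝓡 n) (P := fun p : M × ℝ => q (φ p.2 (G p.1)) - q (F p.1))
    (d := d) ?_ hc (Eventually.of_forall fun y => ?_) ?_ hd0
  · refine ContMDiffAt.sub ?_ ?_
    · have hq' : ContMDiffAt (𝓡 n) 𝓘(ℝ, ℝ) ∞ q (φ (h x) (G x)) := by rwa [← hh]
      refine ContMDiffAt.comp (I' := 𝓡 n) (x, h x) (g := q) (f := fun p : M × ℝ => φ p.2 (G p.1))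
        hq' ?_
      exact (hφ.smooth.comp (f := fun p : M × ℝ => (p.2, G p.1))
        (contMDiff_snd.prodMk (hG.comp contMDiff_fst))).contMDiffAt
    · exact ContMDiffAt.comp (I' := 𝓡 n) (x, h x) (g := q) (f := fun p : M × ℝ => F p.1)
        hq (hF.comp contMDiff_fst).contMDiffAt
  · simp only [← hh, sub_self]
  · refine HasDerivAt.sub_const (q (F x)) ?_
    refine hasDerivAt_comp_flow_of_zero (φ := φ) (q := q) (x := G x) ?_
    rwa [← hh]

variable [CompactSpace M] [T2Space M]

theorem eq_zero_of_mul_bounded {a B : ℝ} (h : ∀ t : ℝ, |a * t| ≤ B) : a = 0 := by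
  by_contra ha
  have := h ((B + 1) / a)
  rw [mul_div_cancel₀ _ ha] at this
  linarith [le_abs_self (B + 1)]

theorem isCohomologousToConst_of_free (hφ : IsSmoothLocallyFree n φ) (hr : IsParameterRigid n φ)
    (hK : IsMinimalSet φ (univ : Set M)) (hfree : ∀ x t, φ t x = x → t = 0)
    (hg : ContMDiff (𝓡 n) 𝓘(ℝ, ℝ) ∞ g) : IsCohomologousToConst n φ g := by
  obtain ⟨C, hC0, hC⟩ := exists_abs_le_of_continuous hg.continuous
  -- Adding a constant makes the function nonnegative and only alters the final constant c.
  have hg' : ContMDiff (𝓡 n) 𝓘(ℝ, ℝ) ∞ fun y => C + g y := contMDiff_const.add hg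
  have hg'0 : ∀ y, 0 ≤ C + g y := fun y => by linarith [(abs_le.1 (hC y)).1]
  obtain ⟨l₁, l₂, F, c, p₁, p₂, -, -, hl, hF⟩ := hr.exists_isLeafConj hφ hg' hg'0
  have s₁ := isSpeed_one_add_mul hg' hg'0 p₁
  have s₂ := isSpeed_one_add_mul hg' hg'0 p₂
  obtain ⟨N, hN⟩ := hF.exists_bounded_displacement s₁.continuous s₂ hK
  choose h hhN hFh using fun x => hN (mem_univ x)
  have hinj : ∀ x s t, φ s x = φ t x → s = t := by
    intro x s t hst
    have : φ (-t + s) x = x := by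
      rw [φ.map_add, hst, ← φ.map_add, neg_add_cancel, φ.map_zero_apply]
    linarith [hfree x _ this]
  have hcont : Continuous h := by
    rw [continuous_iff_continuousAt]
    intro x
    refine continuousAt_of_isClosed_of_unique (R := {p : M × ℝ | F p.1 = φ p.2 p.1})
      (isClosed_eq (hF.smooth.continuous.comp continuous_fst)
        (φ.continuous continuous_snd continuous_fst)) hFh (a := 0) (N := N)
      (by simpa using hhN) ?_
    intro t _ ht
    exact hinj x _ _ (Eq.trans (Eq.symm ht) (hFh x))
  have hsm : ContMDiff (𝓡 n) 𝓘(ℝ, ℝ) ∞ h := fun x =>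
    contMDiffAt_of_flow_eq hφ hF.smooth contMDiff_id hFh hcont.continuousAt
  set w : M → ℝ := fun y => clock φ (fun x => 1 + l₂ * (C + g x)) (h y) y with hw
  have hwsm : ContMDiff (𝓡 n) 𝓘(ℝ, ℝ) ∞ w :=
    (contMDiff_clock hφ s₂.smooth).comp (f := fun y => (h y, y)) (hsm.prodMk contMDiff_id)
  have hrel : ∀ t x, w (φ t x) - w x = (c - 1) * t + (c * l₁ - l₂) * (C * t + clock φ g t x) := by
    intro t x
    obtain ⟨h', hFh', hclk⟩ := hF.exists_displacement s₂ (hFh x) t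
    have e : h' = h (φ t x) := hinj (φ t x) _ _ (hFh'.symm.trans (hFh _))
    have e2 : clock φ (fun y => C + g y) t x = C * t + clock φ g t x := by
      have := clock_sub_fun (φ := φ) (f := fun _ => C) continuous_const hg.continuous 1 1 t x
      simp only [one_mul] at this
      rw [this, clock_eq_mul_of_orbit (a := C) fun _ => rfl]
    rw [e, clock_one_add_mul hg'.continuous l₁, clock_one_add_mul hg'.continuous l₂ t, e2] at hclk
    simp only [hw, hclk]
    ring
  -- If the coefficient of the integral of `g` vanished, w would grow like (c − 1)t. Boundedness of
  -- w gives c = 1, hence l₁ = l₂, which is excluded.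
  obtain ⟨B, -, hB⟩ := exists_abs_le_of_continuous hwsm.continuous
  have ha : c * l₁ - l₂ ≠ 0 := by
    intro h0
    obtain ⟨x⟩ : Nonempty M := ⟨hK.nonempty.some⟩
    have h1 : c - 1 = 0 := eq_zero_of_mul_bounded (B := 2 * B) fun t => by
      have h2 := hrel t x
      rw [h0, zero_mul, add_zero] at h2
      rw [← h2]
      refine (abs_sub _ _).trans ?_
      linarith [hB x, hB (φ t x)]
    have h3 : c = 1 := by linarith
    rw [h3] at h0
    exact hl (by linarith)
  refine ⟨fun y => (c * l₁ - l₂)⁻¹ * w y, -(c - 1) / (c * l₁ - l₂) - C,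
    contMDiff_const.mul hwsm, fun t x => ?_⟩
  have := hrel t x
  field_simp
  linarith

/-- A periodic orbit is closed and, by minimality, is all of M. Subtracting the mean m of `g` over a
period makes its integral D periodic, so D descends to M. -/
theorem isCohomologousToConst_of_periodic (hφ : IsSmoothLocallyFree n φ)
    (hK : IsMinimalSet φ (univ : Set M)) {x₀ : M} {p : ℝ} (hp0 : p ≠ 0) (hp : φ p x₀ = x₀)
    (hg : ContMDiff (𝓡 n) 𝓘(ℝ, ℝ) ∞ g) : IsCohomologousToConst n φ g := by
  let S : AddSubgroup ℝ :=
    { carrier := {t | φ t x₀ = x₀}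
      add_mem' := fun {s t} hs ht => by
        change φ (s + t) x₀ = x₀
        rw [φ.map_add, show φ t x₀ = x₀ from ht, show φ s x₀ = x₀ from hs]
      zero_mem' := φ.map_zero_apply x₀
      neg_mem' := fun {t} ht => by
        change φ (-t) x₀ = x₀
        conv_lhs => rw [← show φ t x₀ = x₀ from ht]
        rw [← φ.map_add, neg_add_cancel, φ.map_zero_apply] }
  have hS : ∀ t, t ∈ S ↔ φ t x₀ = x₀ := fun t => Iff.rfl
  obtain ⟨a, ha0, ha⟩ : ∃ a > 0, S = AddSubgroup.zmultiples a := by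
    rcases AddSubgroup.dense_or_cyclic S with h | ⟨b, hb⟩
    · exfalso
      obtain ⟨U, hU, hUo, h0U⟩ := eventually_nhds_iff.1
        (eventually_nhdsWithin_iff.1 (hφ.locallyFree x₀))
      have h1 : Dense ((S : Set ℝ) \ {0}) := h.sdiff_singleton 0
      obtain ⟨t, htU, htS, ht0⟩ := h1.inter_open_nonempty U hUo ⟨0, h0U⟩
      exact hU t htU ht0 htS
    · rw [← AddSubgroup.zmultiples_eq_closure] at hb
      have hb0 : b ≠ 0 := by
        rintro rfl
        have : p ∈ S := hp
        rw [hb] at this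
        simp at this
        exact hp0 this
      rcases lt_or_gt_of_ne hb0 with h | h
      · exact ⟨-b, by linarith, by rw [hb, AddSubgroup.zmultiples_neg]⟩
      · exact ⟨b, h, hb⟩
  have haS : φ a x₀ = x₀ := (hS a).1 (ha ▸ AddSubgroup.mem_zmultiples a)
  have hper : Function.Periodic (fun t => φ t x₀) a := fun t => by
    simp only
    rw [φ.map_add, haS]
  have hsurj : ∀ y, ∃ t, φ t x₀ = y := by
    have hcomp : IsCompact (φ.orbit x₀) := by
      rw [φ.orbit_eq_range, ← hper.image_uIcc ha0.ne' 0]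
      exact isCompact_uIcc.image (continuous_orbitMap φ x₀)
    have h2 := hK.closure_orbit (mem_univ x₀)
    rw [hcomp.isClosed.closure_eq] at h2
    intro y
    have : y ∈ φ.orbit x₀ := h2 ▸ mem_univ y
    exact this
  set m := clock φ g a x₀ / a with hm
  set D : ℝ → ℝ := fun t => clock φ g t x₀ - m * t with hD
  have hDper : Function.Periodic D a := fun t => by
    simp only [hD]
    rw [add_comm t a, clock_add hg.continuous, haS, hm]
    field_simp
    ring
  have hdiff : ∀ s t, φ s x₀ = φ t x₀ → ∃ k : ℤ, s = t + k * a := by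
    intro s t hst
    have h3 : -t + s ∈ S := by
      rw [hS, φ.map_add, hst, ← φ.map_add, neg_add_cancel, φ.map_zero_apply]
    rw [ha, AddSubgroup.mem_zmultiples_iff] at h3
    obtain ⟨k, hk⟩ := h3
    refine ⟨k, ?_⟩
    rw [zsmul_eq_mul] at hk
    linarith
  have hDeq : ∀ s t, φ s x₀ = φ t x₀ → D s = D t := by
    intro s t hst
    obtain ⟨k, rfl⟩ := hdiff s t hst
    exact (hDper.int_mul k) t
  -- T is an arbitrary choice of time; D ∘ T does not depend on it. For smoothness at x it is
  -- replaced by times T' within half a period of T x, which are unique at x and hence continuous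
  -- there.
  choose T hT using hsurj
  have hDsm : ContDiff ℝ ∞ D := by
    have h4 : ContMDiff 𝓘(ℝ, ℝ) 𝓘(ℝ, ℝ) ∞ fun t => clock φ g t x₀ :=
      (contMDiff_clock hφ hg).comp (f := fun t : ℝ => (t, x₀))
        (contMDiff_id.prodMk contMDiff_const)
    exact h4.contDiff.sub (contDiff_const.mul contDiff_id)
  refine ⟨fun y => D (T y), m, fun x => ?_, fun t x => ?_⟩
  · have hloc : ∀ y, ∃ t, |t - T x| ≤ a / 2 ∧ φ t x₀ = y := by
      intro y
      obtain ⟨t, ht, hty⟩ := hper.exists_mem_Ico ha0 (T y) (T x - a / 2)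
      refine ⟨t, abs_le.2 ⟨by linarith [ht.1], by linarith [ht.2]⟩, ?_⟩
      rw [← hT y]
      exact hty.symm
    choose T' hT'b hT' using hloc
    have huniq : ∀ t, |t - T x| ≤ a / 2 → φ t x₀ = x → t = T x := by
      intro t ht htx
      obtain ⟨k, hk⟩ := hdiff t (T x) (htx.trans (hT x).symm)
      have h5 : |(k : ℝ)| * a ≤ a / 2 := by
        rw [hk, add_sub_cancel_left, abs_mul, abs_of_pos ha0] at ht
        exact ht
      have h6 : |(k : ℝ)| < 1 := by
        by_contra! h7
        nlinarith
      have h8 : k = 0 := by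
        rw [← Int.cast_abs] at h6
        exact Int.abs_lt_one_iff.1 (by exact_mod_cast h6)
      rw [hk, h8]
      simp
    have hcont : ContinuousAt T' x := by
      refine continuousAt_of_isClosed_of_unique (R := {p : M × ℝ | φ p.2 x₀ = p.1})
        (isClosed_eq (φ.continuous continuous_snd continuous_const) continuous_fst) hT'
        (a := T x) (N := a / 2) hT'b ?_
      intro t ht htx
      rw [huniq t ht htx, huniq _ (hT'b x) (hT' x)]
    have hsm : ContMDiffAt (𝓡 n) 𝓘(ℝ, ℝ) ∞ T' x :=
      contMDiffAt_of_flow_eq hφ (F := id) (G := fun _ => x₀) contMDiff_id contMDiff_const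
        (fun y => (hT' y).symm) hcont
    have heq : (fun y => D (T y)) = D ∘ T' := by
      ext y
      exact hDeq _ _ ((hT y).trans (hT' y).symm)
    rw [heq]
    exact ContMDiffAt.comp (I' := 𝓘(ℝ, ℝ)) x hDsm.contDiffAt.contMDiffAt hsm
  · have h9 : D (T (φ t x)) = D (T x + t) := by
      refine hDeq _ _ ?_
      rw [hT, add_comm, φ.map_add, hT]
    simp only [h9]
    simp only [hD]
    rw [clock_add hg.continuous, hT]
    ring

theorem IsParameterRigid.isCohomologousToConst [Nonempty M] (hφ : IsSmoothLocallyFree n φ)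
    (hr : IsParameterRigid n φ) (hg : ContMDiff (𝓡 n) 𝓘(ℝ, ℝ) ∞ g) :
    IsCohomologousToConst n φ g := by
  have hK := isMinimalSet_univ hφ hr
  by_cases h : ∀ x t, φ t x = x → t = 0
  · exact isCohomologousToConst_of_free hφ hr hK h hg
  · push Not at h
    obtain ⟨x, p, hp, hp0⟩ := h
    exact isCohomologousToConst_of_periodic hφ hK hp0 hp hg

end Cohomology

/-! ### Invariant measures and unique ergodicity -/

section InvariantMeasure

variable {M : Type*} [TopologicalSpace M] [CompactSpace M] [T2Space M] [MeasurableSpace M]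
  [BorelSpace M] (φ : Flow ℝ M)

/-- The time average along the orbit of `x`, as a limit along an ultrafilter. -/
noncomputable def timeAverage (U : Ultrafilter ℝ) (x : M) (f : M → ℝ) : ℝ :=
  limUnder (U : Filter ℝ) fun T => T⁻¹ * clock φ f T x

variable {φ}

theorem tendsto_timeAverage {U : Ultrafilter ℝ} (x : M) {f : M → ℝ} (hf : Continuous f) :
    Tendsto (fun T => T⁻¹ * clock φ f T x) U (𝓝 (timeAverage φ U x f)) := by
  obtain ⟨C, hC0, hC⟩ := exists_abs_le_of_continuous hf
  have hb : ∀ T : ℝ, T⁻¹ * clock φ f T x ∈ Icc (-C) C := by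
    intro T
    refine abs_le.1 ?_
    rcases eq_or_ne T 0 with rfl | hT
    · simpa using hC0
    · have := abs_clock_le (φ := φ) hC T x
      rw [abs_mul, abs_inv, inv_mul_le_iff₀ (abs_pos.2 hT), mul_comm]
      exact this
  obtain ⟨a, -, ha⟩ := isCompact_Icc.ultrafilter_le_nhds (U.map fun T => T⁻¹ * clock φ f T x)
    (le_principal_iff.2 (show ∀ᶠ T in (U : Filter ℝ), T⁻¹ * clock φ f T x ∈ _ from
      Eventually.of_forall hb))
  exact tendsto_nhds_limUnder ⟨a, ha⟩

theorem clock_comp_flow {f : M → ℝ} (hf : Continuous f) (s T : ℝ) (x : M) :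
    clock φ (fun y => f (φ s y)) T x = clock φ f T x + clock φ f s (φ T x) - clock φ f s x := by
  have h1 : clock φ (fun y => f (φ s y)) T x = clock φ f T (φ s x) := by
    simp only [clock]
    congr 1
    ext r
    rw [← φ.map_add, ← φ.map_add, add_comm]
  have h2 := clock_add (φ := φ) hf s T x
  have h3 := clock_add (φ := φ) hf T s x
  rw [add_comm] at h2
  rw [h1]
  linarith

/-- Shifting along the flow changes the integral over [0, T] only by two bounded boundary terms,
which disappear after division by T. -/
theorem timeAverage_comp_flow {U : Ultrafilter ℝ} (hU : (U : Filter ℝ) ≤ atTop) (x : M) {f : M → ℝ}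
    (hf : Continuous f) (s : ℝ) :
    timeAverage φ U x (fun y => f (φ s y)) = timeAverage φ U x f := by
  have h1 := tendsto_timeAverage (φ := φ) (U := U) x (hf.comp (φ.continuous_toFun s))
  have h2 := tendsto_timeAverage (φ := φ) (U := U) x hf
  obtain ⟨C, hC0, hC⟩ := exists_abs_le_of_continuous hf
  have h3 : Tendsto (fun T : ℝ => T⁻¹ * (clock φ f s (φ T x) - clock φ f s x)) U (𝓝 0) := by
    have h4 : Tendsto (fun T : ℝ => T⁻¹) U (𝓝 0) := tendsto_inv_atTop_zero.mono_left hU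
    refine h4.zero_mul_isBoundedUnder_le ?_
    refine isBoundedUnder_of ⟨C * |s| + C * |s|, fun T => ?_⟩
    refine (norm_sub_le _ _).trans (add_le_add (abs_clock_le hC _ _) (abs_clock_le hC _ _))
  refine tendsto_nhds_unique h1 ?_
  have h5 := h2.add h3
  rw [add_zero] at h5
  refine h5.congr fun T => ?_
  simp only [Function.comp_def]
  rw [clock_comp_flow hf]
  ring

open CompactlySupported in
/-- The positive functional of time averages. -/
noncomputable def timeAverageFunctional (φ : Flow ℝ M) (U : Ultrafilter ℝ)
    (hU : (U : Filter ℝ) ≤ atTop) (x : M) : C_c(M, ℝ) →ₚ[ℝ] ℝ :=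
  PositiveLinearMap.mk₀
    { toFun := fun f => timeAverage φ U x f
      map_add' := fun f g => by
        refine tendsto_nhds_unique (tendsto_timeAverage (φ := φ) x (f + g).continuous) ?_
        refine ((tendsto_timeAverage (φ := φ) x f.continuous).add
          (tendsto_timeAverage (φ := φ) x g.continuous)).congr fun T => ?_
        have := clock_sub_fun (φ := φ) f.continuous g.continuous 1 1 T x
        simp only [one_mul] at this
        rw [← mul_add, ← this]
        rfl
      map_smul' := fun c f => by
        refine tendsto_nhds_unique (tendsto_timeAverage (φ := φ) x (c • f).continuous) ?_
        refine ((tendsto_timeAverage (φ := φ) x f.continuous).const_mul c).congr fun T => ?_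
        have := clock_sub_fun (φ := φ) f.continuous f.continuous c 0 T x
        simp only [zero_mul, add_zero] at this
        rw [mul_left_comm, ← this]
        rfl }
    (fun f hf => by
      refine ge_of_tendsto (tendsto_timeAverage (φ := φ) x f.continuous) ?_
      filter_upwards [hU (Ici_mem_atTop (0 : ℝ))] with T hT
      have := clock_mono_of_nonneg (φ := φ) f.continuous (fun y => hf y) x (mem_Ici.1 hT)
      simp only [clock_zero] at this
      exact mul_nonneg (inv_nonneg.2 hT) this)

variable [SecondCountableTopology M]

/-- Krylov–Bogolyubov: the ultrafilter limit of time averages is a positive linear functional, and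
Riesz representation turns it into a measure. -/
theorem exists_invariant_measure [Nonempty M] (φ : Flow ℝ M) :
    ∃ μ : Measure M, IsProbabilityMeasure μ ∧ ∀ t : ℝ, MeasurePreserving (φ t) μ μ := by
  obtain ⟨x⟩ := ‹Nonempty M›
  let U : Ultrafilter ℝ := Ultrafilter.of atTop
  have hU : (U : Filter ℝ) ≤ atTop := Ultrafilter.of_le _
  let Λ := timeAverageFunctional φ U hU x
  have hΛ : ∀ f : C(M, ℝ), ∫ y, f y ∂(RealRMK.rieszMeasure Λ) = timeAverage φ U x f := fun f =>
    RealRMK.integral_rieszMeasure Λ (CompactlySupportedContinuousMap.continuousMapEquiv f)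
  set μ := RealRMK.rieszMeasure Λ
  have h1 : timeAverage φ U x (fun _ => 1) = 1 := by
    refine tendsto_nhds_unique (tendsto_timeAverage (φ := φ) x continuous_const) ?_
    refine tendsto_const_nhds.congr' ?_
    filter_upwards [hU (Ioi_mem_atTop (0 : ℝ))] with T hT
    have hT0 : T ≠ 0 := (mem_Ioi.1 hT).ne'
    rw [clock_eq_mul_of_orbit (a := 1) fun _ => rfl]
    field_simp
  have hprob : IsProbabilityMeasure μ := by
    have h2 := hΛ (ContinuousMap.const M 1)
    simp only [ContinuousMap.const_apply, integral_const, smul_eq_mul, mul_one] at h2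
    refine ⟨?_⟩
    have h3 : μ.real univ = 1 := h2.trans h1
    rw [Measure.real, ENNReal.toReal_eq_one_iff] at h3
    exact h3
  refine ⟨μ, hprob, fun t => ⟨(φ.continuous_toFun t).measurable, ?_⟩⟩
  have : TopologicalSpace.MetrizableSpace M := inferInstance
  have hm : IsProbabilityMeasure (μ.map (φ t)) :=
    Measure.isProbabilityMeasure_map (φ.continuous_toFun t).measurable.aemeasurable
  refine ext_of_forall_integral_eq_of_IsFiniteMeasure fun f => ?_
  rw [integral_map (φ.continuous_toFun t).measurable.aemeasurable
    f.continuous.aestronglyMeasurable]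
  have e1 := hΛ ⟨fun y => f (φ t y), f.continuous.comp (φ.continuous_toFun t)⟩
  have e2 := hΛ ⟨f, f.continuous⟩
  simp only [ContinuousMap.coe_mk] at e1 e2
  rw [e1, e2]
  exact timeAverage_comp_flow hU x f.continuous t

theorem integrable_of_continuous {μ : Measure M} [IsFiniteMeasure μ] {f : M → ℝ}
    (hf : Continuous f) : Integrable f μ := by
  simpa using hf.continuousOn.integrableOn_compact (μ := μ) isCompact_univ

/-- Integrate the equation at time 1: by Fubini and invariance the left side is the integral of `g`,
while the two u terms cancel. -/
theorem integral_eq_of_isCohomologousToConst {μ : Measure M} [IsProbabilityMeasure μ]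
    (hμ : ∀ t : ℝ, MeasurePreserving (φ t) μ μ) {g u : M → ℝ} {c : ℝ} (hg : Continuous g)
    (hu : Continuous u) (h : ∀ t x, clock φ g t x = u (φ t x) - u x + c * t) :
    ∫ x, g x ∂μ = c := by
  have hinv : ∀ (f : M → ℝ), Continuous f → ∀ t, ∫ x, f (φ t x) ∂μ = ∫ x, f x ∂μ := by
    intro f hf t
    rw [← integral_map (hμ t).measurable.aemeasurable hf.aestronglyMeasurable, (hμ t).map_eq]
  have h1 : ∫ x, clock φ g 1 x ∂μ = ∫ x, g x ∂μ := by
    simp only [clock]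
    rw [← intervalIntegral_integral_swap]
    · simp [hinv g hg]
    · have hc : Continuous (Function.uncurry fun (s : ℝ) (x : M) => g (φ s x)) :=
        hg.comp φ.cont'
      obtain ⟨C, -, hC⟩ := exists_abs_le_of_continuous hg
      rw [uIoc_of_le zero_le_one]
      have : IsFiniteMeasure ((volume : Measure ℝ).restrict (Ioc 0 1)) :=
        ⟨by simp⟩
      exact Integrable.of_bound hc.aestronglyMeasurable C (Eventually.of_forall fun p => hC _)
  rw [← h1]
  simp only [h, mul_one]
  have hi := integrable_of_continuous (μ := μ) hu
  have hi' : Integrable (fun x => u (φ 1 x)) μ :=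
    integrable_of_continuous (hu.comp (φ.continuous_toFun 1))
  have hs : Integrable (fun x => u (φ 1 x) - u x) μ := hi'.sub hi
  rw [integral_add hs (integrable_const c), integral_sub hi' hi, hinv u hu 1]
  simp

end InvariantMeasure

theorem isUniquelyErgodic_of_isCohomologousToConst {n : ℕ} {M : Type*} [TopologicalSpace M]
    [T2Space M] [CompactSpace M] [Nonempty M] [ChartedSpace (EuclideanSpace ℝ (Fin n)) M]
    [IsManifold (𝓡 n) ∞ M] [MeasurableSpace M] [BorelSpace M] {φ : Flow ℝ M}
    (h : ∀ g : M → ℝ, ContMDiff (𝓡 n) 𝓘(ℝ, ℝ) ∞ g → IsCohomologousToConst n φ g) :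
    IsUniquelyErgodic φ := by
  have := ChartedSpace.secondCountable_of_sigmaCompact (EuclideanSpace ℝ (Fin n)) M
  obtain ⟨μ, hμ, hinv⟩ := exists_invariant_measure φ
  refine ⟨μ, ⟨hμ, hinv⟩, ?_⟩
  rintro ν ⟨hν, hνinv⟩
  have : TopologicalSpace.MetrizableSpace M := inferInstance
  refine ext_of_forall_integral_eq_of_IsFiniteMeasure fun f => ?_
  refine eq_of_forall_dist_le fun ε hε => ?_
  obtain ⟨g, hg, -⟩ := f.continuous.exists_contMDiff_approx (𝓡 n) ⊤
    (continuous_const (y := ε / 2)) (fun _ => half_pos hε)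
  obtain ⟨u, c, hu, hc⟩ := h g g.contMDiff
  have hgc : Continuous g := g.contMDiff.continuous
  have e1 := integral_eq_of_isCohomologousToConst hinv hgc hu.continuous hc
  have e2 := integral_eq_of_isCohomologousToConst hνinv hgc hu.continuous hc
  have key : ∀ (m : Measure M) [IsProbabilityMeasure m], dist (∫ x, f x ∂m) (∫ x, g x ∂m) ≤ ε / 2 := by
    intro m _
    rw [dist_eq_norm, ← integral_sub (integrable_of_continuous f.continuous)
      (integrable_of_continuous hgc)]
    refine (norm_integral_le_of_norm_le_const (C := ε / 2) (Eventually.of_forall fun x => ?_)).trans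
      (by simp)
    rw [← dist_eq_norm, dist_comm]
    exact (hg x).le
  calc dist (∫ x, f x ∂ν) (∫ x, f x ∂μ)
      ≤ dist (∫ x, f x ∂ν) (∫ x, g x ∂ν) + dist (∫ x, f x ∂μ) (∫ x, g x ∂ν) :=
        dist_triangle_right _ _ _
    _ ≤ ε / 2 + ε / 2 := by
        refine add_le_add (key ν) ?_
        rw [e2, ← e1]
        exact key μ
    _ = ε := add_halves ε

/-! ### Determinants, charts and smooth densities -/

section Det

variable {n : ℕ}

theorem contDiff_det : ContDiff ℝ ∞ fun A : EuclideanSpace ℝ (Fin n) →L[ℝ] EuclideanSpace ℝ (Fin n)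
    => A.det := by
  let b := (EuclideanSpace.basisFun (Fin n) ℝ).toBasis
  have h : (fun A : EuclideanSpace ℝ (Fin n) →L[ℝ] EuclideanSpace ℝ (Fin n) => A.det) =
      fun A => ∑ σ : Equiv.Perm (Fin n), (Equiv.Perm.sign σ : ℤ) • ∏ i,
        (A (b i)) (σ i) := by
    ext A
    rw [ContinuousLinearMap.det, ← LinearMap.det_toMatrix b, Matrix.det_apply]
    refine Finset.sum_congr rfl fun σ _ => ?_
    simp only [LinearMap.toMatrix_apply]
    rfl
  rw [h]
  refine ContDiff.sum fun σ _ => ContDiff.const_smul _ (contDiff_prod fun i _ => ?_)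
  have h1 : ContDiff ℝ ∞ fun A : EuclideanSpace ℝ (Fin n) →L[ℝ] EuclideanSpace ℝ (Fin n) =>
      A (b i) := contDiff_id.clm_apply contDiff_const
  exact (EuclideanSpace.proj (𝕜 := ℝ) (σ i)).contDiff.comp h1

theorem det_comp (A B : EuclideanSpace ℝ (Fin n) →L[ℝ] EuclideanSpace ℝ (Fin n)) :
    (A.comp B).det = A.det * B.det :=
  LinearMap.det_comp _ _

theorem det_id : (ContinuousLinearMap.id ℝ (EuclideanSpace ℝ (Fin n))).det = 1 :=
  LinearMap.det_id

end Det

section Charts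

variable {n : ℕ} {M : Type*} [TopologicalSpace M] [ChartedSpace (EuclideanSpace ℝ (Fin n)) M]
  [IsManifold (𝓡 n) ∞ M]

/-- The derivative of a map between manifolds, in the canonical trivializations of the tangent
spaces. -/
noncomputable def tderiv (n : ℕ) {M : Type*} [TopologicalSpace M]
    [ChartedSpace (EuclideanSpace ℝ (Fin n)) M] (ψ : M → M) (x : M) :
    EuclideanSpace ℝ (Fin n) →L[ℝ] EuclideanSpace ℝ (Fin n) := mfderiv (𝓡 n) (𝓡 n) ψ x

/-- The derivative of a chart. -/
noncomputable def chartDeriv (e : OpenPartialHomeomorph M (EuclideanSpace ℝ (Fin n))) (x : M) :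
    EuclideanSpace ℝ (Fin n) →L[ℝ] EuclideanSpace ℝ (Fin n) :=
  mfderiv (𝓡 n) 𝓘(ℝ, EuclideanSpace ℝ (Fin n)) e x

/-- The derivative of the inverse of a chart. -/
noncomputable def chartSymmDeriv (e : OpenPartialHomeomorph M (EuclideanSpace ℝ (Fin n)))
    (z : EuclideanSpace ℝ (Fin n)) :
    EuclideanSpace ℝ (Fin n) →L[ℝ] EuclideanSpace ℝ (Fin n) :=
  mfderiv 𝓘(ℝ, EuclideanSpace ℝ (Fin n)) (𝓡 n) e.symm z

variable {e e' : OpenPartialHomeomorph M (EuclideanSpace ℝ (Fin n))}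

theorem hasMFDerivAt_chart (he : e ∈ IsManifold.maximalAtlas (𝓡 n) ∞ M) {x : M}
    (hx : x ∈ e.source) :
    HasMFDerivAt (𝓡 n) 𝓘(ℝ, EuclideanSpace ℝ (Fin n)) e x (chartDeriv e x) :=
  ((contMDiffAt_of_mem_maximalAtlas he hx).mdifferentiableAt (by simp)).hasMFDerivAt

theorem hasMFDerivAt_chart_symm (he : e ∈ IsManifold.maximalAtlas (𝓡 n) ∞ M)
    {z : EuclideanSpace ℝ (Fin n)} (hz : z ∈ e.target) :
    HasMFDerivAt 𝓘(ℝ, EuclideanSpace ℝ (Fin n)) (𝓡 n) e.symm z (chartSymmDeriv e z) :=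
  ((contMDiffAt_symm_of_mem_maximalAtlas he hz).mdifferentiableAt (by simp)).hasMFDerivAt

theorem hasMFDerivAt_tderiv {ψ : M → M} (hψ : ContMDiff (𝓡 n) (𝓡 n) ∞ ψ) (x : M) :
    HasMFDerivAt (𝓡 n) (𝓡 n) ψ x (tderiv n ψ x) :=
  (hψ.mdifferentiableAt (by simp)).hasMFDerivAt

theorem tderiv_comp {ψ χ : M → M} (hψ : ContMDiff (𝓡 n) (𝓡 n) ∞ ψ)
    (hχ : ContMDiff (𝓡 n) (𝓡 n) ∞ χ) (x : M) :
    tderiv n (ψ ∘ χ) x = (tderiv n ψ (χ x)).comp (tderiv n χ x) :=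
  ((hasMFDerivAt_tderiv hψ (χ x)).comp x (hasMFDerivAt_tderiv hχ x)).mfderiv

theorem tderiv_id (x : M) : tderiv n (id : M → M) x = ContinuousLinearMap.id ℝ _ :=
  mfderiv_id

theorem chartDeriv_comp_chartSymmDeriv (he : e ∈ IsManifold.maximalAtlas (𝓡 n) ∞ M)
    {z : EuclideanSpace ℝ (Fin n)} (hz : z ∈ e.target) :
    (chartDeriv e (e.symm z)).comp (chartSymmDeriv e z) = ContinuousLinearMap.id ℝ _ := by
  have h1 : HasFDerivAt (e ∘ e.symm)
      ((chartDeriv e (e.symm z)).comp (chartSymmDeriv e z)) z :=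
    ((hasMFDerivAt_chart he (e.map_target hz)).comp z (hasMFDerivAt_chart_symm he hz)).hasFDerivAt
  have h2 : HasFDerivAt (e ∘ e.symm) (ContinuousLinearMap.id ℝ _) z := by
    refine (hasFDerivAt_id z).congr_of_eventuallyEq ?_
    filter_upwards [e.open_target.mem_nhds hz] with w hw
    exact e.right_inv hw
  exact h1.unique h2

theorem det_chartDeriv_mul (he : e ∈ IsManifold.maximalAtlas (𝓡 n) ∞ M)
    {z : EuclideanSpace ℝ (Fin n)} (hz : z ∈ e.target) :
    (chartDeriv e (e.symm z)).det * (chartSymmDeriv e z).det = 1 := by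
  rw [← det_comp, chartDeriv_comp_chartSymmDeriv he hz, det_id]

theorem det_chartDeriv_mul' (he : e ∈ IsManifold.maximalAtlas (𝓡 n) ∞ M) {x : M}
    (hx : x ∈ e.source) : (chartDeriv e x).det * (chartSymmDeriv e (e x)).det = 1 := by
  have := det_chartDeriv_mul he (e.map_source hx)
  rwa [e.left_inv hx] at this

theorem hasFDerivAt_in_charts (he : e ∈ IsManifold.maximalAtlas (𝓡 n) ∞ M)
    (he' : e' ∈ IsManifold.maximalAtlas (𝓡 n) ∞ M) {ψ : M → M} (hψ : ContMDiff (𝓡 n) (𝓡 n) ∞ ψ)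
    {z : EuclideanSpace ℝ (Fin n)} (hz : z ∈ e.target) (hz' : ψ (e.symm z) ∈ e'.source) :
    HasFDerivAt (fun z => e' (ψ (e.symm z))) (((chartDeriv e' (ψ (e.symm z))).comp
      (tderiv n ψ (e.symm z))).comp (chartSymmDeriv e z)) z :=
  (((hasMFDerivAt_chart he' hz').comp (e.symm z) (hasMFDerivAt_tderiv hψ _)).comp z
    (hasMFDerivAt_chart_symm he hz)).hasFDerivAt

theorem det_fderiv_in_charts (he : e ∈ IsManifold.maximalAtlas (𝓡 n) ∞ M)
    (he' : e' ∈ IsManifold.maximalAtlas (𝓡 n) ∞ M) {ψ : M → M} (hψ : ContMDiff (𝓡 n) (𝓡 n) ∞ ψ)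
    {z : EuclideanSpace ℝ (Fin n)} (hz : z ∈ e.target) (hz' : ψ (e.symm z) ∈ e'.source) :
    (fderiv ℝ (fun z => e' (ψ (e.symm z))) z).det =
      (chartDeriv e' (ψ (e.symm z))).det * (tderiv n ψ (e.symm z)).det *
        (chartSymmDeriv e z).det := by
  rw [(hasFDerivAt_in_charts he he' hψ hz hz').fderiv, det_comp, det_comp]

theorem det_fderiv_coord_change (he : e ∈ IsManifold.maximalAtlas (𝓡 n) ∞ M)
    (he' : e' ∈ IsManifold.maximalAtlas (𝓡 n) ∞ M)
    {z : EuclideanSpace ℝ (Fin n)} (hz : z ∈ e.target) (hz' : e.symm z ∈ e'.source) :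
    (fderiv ℝ (fun z => e' (e.symm z)) z).det =
      (chartDeriv e' (e.symm z)).det * (chartSymmDeriv e z).det := by
  have := det_fderiv_in_charts he he' contMDiff_id hz hz'
  simp only [id, tderiv_id, det_id, mul_one] at this
  exact this

theorem contDiffOn_coord_change (he : e ∈ IsManifold.maximalAtlas (𝓡 n) ∞ M)
    (he' : e' ∈ IsManifold.maximalAtlas (𝓡 n) ∞ M) :
    ContDiffOn ℝ ∞ (fun z => e' (e.symm z)) (e.target ∩ e.symm ⁻¹' e'.source) := by
  rw [← contMDiffOn_iff_contDiffOn]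
  exact (contMDiffOn_of_mem_maximalAtlas he').comp
    ((contMDiffOn_symm_of_mem_maximalAtlas he).mono inter_subset_left) fun z hz => hz.2

theorem isOpen_coord_change_domain (e e' : OpenPartialHomeomorph M (EuclideanSpace ℝ (Fin n))) :
    IsOpen (e.target ∩ e.symm ⁻¹' e'.source) :=
  e.symm.isOpen_inter_preimage e'.open_source

/-- A positive weight `w` on `M` such that `w x * |det v|` is a smooth density. -/
structure IsDensityWeight (n : ℕ) {M : Type*} [TopologicalSpace M]
    [ChartedSpace (EuclideanSpace ℝ (Fin n)) M] (w : M → ℝ) : Prop where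
  pos : ∀ x, 0 < w x
  smooth : ∀ p : M, ContDiffOn ℝ ∞ (fun z => w ((chartAt (EuclideanSpace ℝ (Fin n)) p).symm z) *
    |(chartSymmDeriv (chartAt (EuclideanSpace ℝ (Fin n)) p) z).det|)
    (chartAt (EuclideanSpace ℝ (Fin n)) p).target

theorem IsDensityWeight.smul {w u : M → ℝ} (hw : IsDensityWeight n w)
    (hu : ContMDiff (𝓡 n) 𝓘(ℝ, ℝ) ∞ u) (hu0 : ∀ x, 0 < u x) :
    IsDensityWeight n (fun x => u x * w x) where
  pos x := mul_pos (hu0 x) (hw.pos x)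
  smooth p := by
    simp only [mul_assoc]
    refine ContDiffOn.mul ?_ (hw.smooth p)
    rw [← contMDiffOn_iff_contDiffOn]
    exact hu.comp_contMDiffOn (contMDiffOn_symm_of_mem_maximalAtlas
      (IsManifold.chart_mem_maximalAtlas p))

/-- Chart volumes are glued by finitely many bump functions whose supports cover M. In another chart
each summand is a bump times |det| of a coordinate change, smooth because that determinant never
vanishes; off the closed support of the bump the summand is locally zero. -/
theorem exists_isDensityWeight [CompactSpace M] [T2Space M] : ∃ w : M → ℝ, IsDensityWeight n w := by
  let f : ∀ x : M, SmoothBumpFunction (𝓡 n) x := fun x => Classical.arbitrary _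
  obtain ⟨T, hT⟩ := isCompact_univ.elim_finite_subcover (fun x => Function.support (f x))
    (fun x => (f x).isOpen_support) (fun x _ => mem_iUnion.2 ⟨x, (f x).c_mem_support⟩)
  have hsupp : ∀ i x, f i x ≠ 0 → x ∈ (chartAt (EuclideanSpace ℝ (Fin n)) i).source := fun i x hx =>
    (f i).support_subset_source hx
  refine ⟨fun x => ∑ i ∈ T, f i x * |(chartDeriv (chartAt (EuclideanSpace ℝ (Fin n)) i) x).det|,
    fun x => ?_, fun p => ?_⟩
  · obtain ⟨i, hiT, hi⟩ := mem_iUnion₂.1 (hT (mem_univ x))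
    refine Finset.sum_pos' (fun j _ => mul_nonneg (f j).nonneg (abs_nonneg _)) ⟨i, hiT, ?_⟩
    refine mul_pos ((f i).nonneg.lt_of_ne' hi) (abs_pos.2 ?_)
    exact left_ne_zero_of_mul_eq_one
      (det_chartDeriv_mul' (IsManifold.chart_mem_maximalAtlas i) (hsupp i x hi))
  · simp only [Finset.sum_mul]
    refine ContDiffOn.sum fun i _ => ?_
    set e := chartAt (EuclideanSpace ℝ (Fin n)) p
    set e' := chartAt (EuclideanSpace ℝ (Fin n)) i
    have he : e ∈ IsManifold.maximalAtlas (𝓡 n) ∞ M := IsManifold.chart_mem_maximalAtlas p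
    have he' : e' ∈ IsManifold.maximalAtlas (𝓡 n) ∞ M := IsManifold.chart_mem_maximalAtlas i
    intro z hz
    refine ContDiffAt.contDiffWithinAt ?_
    have hfs : ContDiffAt ℝ ∞ (fun z => f i (e.symm z)) z := by
      rw [← contMDiffAt_iff_contDiffAt]
      exact (f i).contMDiff.contMDiffAt.comp z (contMDiffAt_symm_of_mem_maximalAtlas he hz)
    by_cases hzi : e.symm z ∈ tsupport (f i)
    · have hz' : e.symm z ∈ e'.source := (f i).tsupport_subset_chartAt_source hzi
      have hO := (isOpen_coord_change_domain e e').mem_nhds ⟨hz, hz'⟩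
      have h1 : ContDiffAt ℝ ∞ (fun z => (fderiv ℝ (fun z => e' (e.symm z)) z).det) z := by
        refine contDiff_det.contDiffAt.comp z ?_
        exact ((contDiffOn_coord_change he he').contDiffAt hO).fderiv_right (by simp)
      have h2 : (fderiv ℝ (fun z => e' (e.symm z)) z).det ≠ 0 := by
        rw [det_fderiv_coord_change he he' hz hz']
        exact mul_ne_zero (left_ne_zero_of_mul_eq_one (det_chartDeriv_mul' he' hz'))
          (right_ne_zero_of_mul_eq_one (det_chartDeriv_mul he hz))
      refine (hfs.mul (h1.abs h2)).congr_of_eventuallyEq ?_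
      filter_upwards [hO] with y hy
      rw [det_fderiv_coord_change he he' hy.1 hy.2, abs_mul, mul_assoc]
    · refine (contDiffAt_const (c := (0 : ℝ))).congr_of_eventuallyEq ?_
      have hO : e.target ∩ e.symm ⁻¹' (tsupport (f i))ᶜ ∈ 𝓝 z :=
        (e.symm.isOpen_inter_preimage (isClosed_tsupport _).isOpen_compl).mem_nhds ⟨hz, hzi⟩
      filter_upwards [hO] with y hy
      rw [image_eq_zero_of_notMem_tsupport hy.2]
      simp

end Charts

/-! ### The Jacobian cocycle and the divergence -/

section LogJacobian

variable {n : ℕ} {M : Type*} [TopologicalSpace M] [ChartedSpace (EuclideanSpace ℝ (Fin n)) M]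

/-- The logarithm of the Jacobian of the flow with respect to the density of weight `w`. -/
noncomputable def logJacobian (n : ℕ) {M : Type*} [TopologicalSpace M]
    [ChartedSpace (EuclideanSpace ℝ (Fin n)) M] (φ : Flow ℝ M) (w : M → ℝ) (t : ℝ) (x : M) : ℝ :=
  Real.log (w (φ t x)) + Real.log (tderiv n (φ t) x).det - Real.log (w x)

variable [IsManifold (𝓡 n) ∞ M] {φ : Flow ℝ M} {w : M → ℝ}

theorem flow_zero_eq_id (φ : Flow ℝ M) : φ.toFun 0 = id := funext φ.map_zero_apply

theorem tderiv_flow_add (hφ : IsSmoothLocallyFree n φ) (s t : ℝ) (x : M) :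
    tderiv n (φ (s + t)) x = (tderiv n (φ s) (φ t x)).comp (tderiv n (φ t) x) := by
  rw [← tderiv_comp (hφ.contMDiff_apply s) (hφ.contMDiff_apply t)]
  congr 1
  ext y
  exact φ.map_add s t y

theorem det_tderiv_flow_ne_zero (hφ : IsSmoothLocallyFree n φ) (t : ℝ) (x : M) :
    (tderiv n (φ t) x).det ≠ 0 := by
  have h := tderiv_flow_add hφ (-t) t x
  rw [neg_add_cancel, flow_zero_eq_id, tderiv_id] at h
  have h2 := congrArg ContinuousLinearMap.det h
  rw [det_id, det_comp] at h2
  exact right_ne_zero_of_mul_eq_one h2.symm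

theorem logJacobian_zero (x : M) : logJacobian n φ w 0 x = 0 := by
  rw [logJacobian, flow_zero_eq_id, tderiv_id, det_id, Real.log_one]
  simp

/-- This is the chain rule. `Real.log` depends only on the absolute value, so the sign of the
determinant, and orientability, play no role. -/
theorem logJacobian_add (hφ : IsSmoothLocallyFree n φ) (s t : ℝ) (x : M) :
    logJacobian n φ w (s + t) x = logJacobian n φ w s (φ t x) + logJacobian n φ w t x := by
  simp only [logJacobian]
  rw [tderiv_flow_add hφ, det_comp, Real.log_mul (det_tderiv_flow_ne_zero hφ _ _)
    (det_tderiv_flow_ne_zero hφ _ _), φ.map_add]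
  ring

/-- In a chart, the flow and the determinants of its derivatives are smooth near time zero. -/
theorem exists_flow_in_chart (hφ : IsSmoothLocallyFree n φ)
    {e : OpenPartialHomeomorph M (EuclideanSpace ℝ (Fin n))}
    (he : e ∈ IsManifold.maximalAtlas (𝓡 n) ∞ M) :
    ∃ Ω : Set (ℝ × EuclideanSpace ℝ (Fin n)), IsOpen Ω ∧
      (∀ z ∈ e.target, ((0 : ℝ), z) ∈ Ω) ∧
      (∀ q ∈ Ω, q.2 ∈ e.target ∧ φ q.1 (e.symm q.2) ∈ e.source) ∧
      ContDiffOn ℝ ∞ (fun q => e (φ q.1 (e.symm q.2))) Ω ∧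
      ContDiffOn ℝ ∞ (fun q => (chartDeriv e (φ q.1 (e.symm q.2))).det *
        (tderiv n (φ q.1) (e.symm q.2)).det * (chartSymmDeriv e q.2).det) Ω := by
  let E := EuclideanSpace ℝ (Fin n)
  have hU : IsOpen (univ ×ˢ e.target : Set (ℝ × E)) := isOpen_univ.prod e.open_target
  have hsm : ContMDiffOn 𝓘(ℝ, ℝ × E) (𝓡 n) ∞ (fun q : ℝ × E => φ q.1 (e.symm q.2))
      (univ ×ˢ e.target) := by
    refine hφ.smooth.comp_contMDiffOn (f := fun q : ℝ × E => (q.1, e.symm q.2)) ?_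
    refine ContMDiffOn.prodMk ?_ ?_
    · rw [contMDiffOn_iff_contDiffOn]
      exact contDiff_fst.contDiffOn
    · refine (contMDiffOn_symm_of_mem_maximalAtlas he).comp (f := fun q : ℝ × E => q.2) ?_
        (fun q hq => hq.2)
      rw [contMDiffOn_iff_contDiffOn]
      exact contDiff_snd.contDiffOn
  let Ω : Set (ℝ × E) := (univ ×ˢ e.target) ∩ (fun q : ℝ × E => φ q.1 (e.symm q.2)) ⁻¹' e.source
  have hΩ : IsOpen Ω := hsm.continuousOn.isOpen_inter_preimage hU e.open_source
  let Φ : ℝ × E → E := fun q => e (φ q.1 (e.symm q.2))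
  have hΦ : ContDiffOn ℝ ∞ Φ Ω := by
    rw [← contMDiffOn_iff_contDiffOn]
    exact (contMDiffOn_of_mem_maximalAtlas he).comp (hsm.mono inter_subset_left) fun q hq => hq.2
  let D : ℝ × E → ℝ := fun q => ((fderiv ℝ Φ q).comp (.inr ℝ ℝ E)).det
  have hD : ContDiffOn ℝ ∞ D Ω := by
    refine contDiff_det.comp_contDiffOn ?_
    exact (hΦ.fderiv_of_isOpen hΩ (by simp)).clm_comp contDiffOn_const
  have hDeq : ∀ q ∈ Ω, D q = (chartDeriv e (φ q.1 (e.symm q.2))).det *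
      (tderiv n (φ q.1) (e.symm q.2)).det * (chartSymmDeriv e q.2).det := by
    rintro ⟨t, z⟩ hq
    rw [← det_fderiv_in_charts he he (hφ.contMDiff_apply t) hq.1.2 hq.2]
    have h1 : HasFDerivAt Φ (fderiv ℝ Φ (t, z)) (t, z) :=
      ((hΦ.contDiffAt (hΩ.mem_nhds hq)).differentiableAt (by simp)).hasFDerivAt
    have h2 : HasFDerivAt (fun y : E => (t, y)) (.inr ℝ ℝ E) z := hasFDerivAt_prodMk_right t z
    have h3 := (h1.comp z h2).fderiv
    change ((fderiv ℝ Φ (t, z)).comp (.inr ℝ ℝ E)).det = _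
    rw [← h3]
    rfl
  refine ⟨Ω, hΩ, fun z hz => ⟨⟨trivial, hz⟩, ?_⟩, fun q hq => ⟨hq.1.2, hq.2⟩, hΦ,
    hD.congr fun q hq => (hDeq q hq).symm⟩
  simp only [mem_preimage, φ.map_zero_apply]
  exact e.map_target hz

/-- In a chart, the logarithmic Jacobian is smooth near time zero. -/
theorem exists_logJacobian_in_chart (hφ : IsSmoothLocallyFree n φ) (hw : IsDensityWeight n w)
    (p : M) :
    ∃ (Ω : Set (ℝ × EuclideanSpace ℝ (Fin n))) (Λ : ℝ × EuclideanSpace ℝ (Fin n) → ℝ),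
      IsOpen Ω ∧ (∀ z ∈ (chartAt (EuclideanSpace ℝ (Fin n)) p).target, ((0 : ℝ), z) ∈ Ω) ∧
      ContDiffOn ℝ ∞ Λ Ω ∧ ∀ t, ∀ x ∈ (chartAt (EuclideanSpace ℝ (Fin n)) p).source,
        (t, chartAt (EuclideanSpace ℝ (Fin n)) p x) ∈ Ω →
        logJacobian n φ w t x = Λ (t, chartAt (EuclideanSpace ℝ (Fin n)) p x) := by
  set e := chartAt (EuclideanSpace ℝ (Fin n)) p with he_def
  have he : e ∈ IsManifold.maximalAtlas (𝓡 n) ∞ M := IsManifold.chart_mem_maximalAtlas p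
  obtain ⟨Ω, hΩ, h0, hΩm, hΦ, hD⟩ := exists_flow_in_chart hφ he
  set Φ : ℝ × EuclideanSpace ℝ (Fin n) → EuclideanSpace ℝ (Fin n) :=
    fun q => e (φ q.1 (e.symm q.2))
  set D : ℝ × EuclideanSpace ℝ (Fin n) → ℝ := fun q => (chartDeriv e (φ q.1 (e.symm q.2))).det *
    (tderiv n (φ q.1) (e.symm q.2)).det * (chartSymmDeriv e q.2).det
  have hne : ∀ z ∈ e.target, (chartSymmDeriv e z).det ≠ 0 := fun z hz =>
    right_ne_zero_of_mul_eq_one (det_chartDeriv_mul he hz)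
  have hne' : ∀ x ∈ e.source, (chartDeriv e x).det ≠ 0 := fun x hx =>
    left_ne_zero_of_mul_eq_one (det_chartDeriv_mul' he hx)
  let r : EuclideanSpace ℝ (Fin n) → ℝ := fun z => w (e.symm z) * |(chartSymmDeriv e z).det|
  have hr : ContDiffOn ℝ ∞ r e.target := hw.smooth p
  have hrpos : ∀ z ∈ e.target, r z ≠ 0 := fun z hz =>
    (mul_pos (hw.pos _) (abs_pos.2 (hne z hz))).ne'
  -- Here r is the density in the chart, Φ the flow in the chart and D its spatial Jacobian. The
  -- chart determinants contained in them cancel.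
  refine ⟨Ω, fun q => Real.log (r (Φ q)) - Real.log (r q.2) + Real.log (D q), hΩ, h0, ?_, ?_⟩
  · have m1 : MapsTo Φ Ω e.target := fun q hq => e.map_source (hΩm q hq).2
    have m2 : MapsTo Prod.snd Ω e.target := fun q hq => (hΩm q hq).1
    refine ((ContDiffOn.log (hr.comp hΦ m1) fun q hq => hrpos _ (m1 hq)).sub
      (ContDiffOn.log (hr.comp contDiff_snd.contDiffOn m2) fun q hq => hrpos _ (m2 hq))).add
      (ContDiffOn.log hD fun q hq => ?_)
    exact mul_ne_zero (mul_ne_zero (hne' _ (hΩm q hq).2) (det_tderiv_flow_ne_zero hφ _ _))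
      (hne _ (hΩm q hq).1)
  · intro t x hx hq
    have hsrc : φ t x ∈ e.source := by
      have := (hΩm _ hq).2
      simpa only [e.left_inv hx] using this
    simp only [r, Φ, D, e.left_inv hx, e.left_inv hsrc]
    have k1 := det_chartDeriv_mul' he hsrc
    have k2 : Real.log (chartDeriv e (φ t x)).det +
        Real.log (chartSymmDeriv e (e (φ t x))).det = 0 := by
      rw [← Real.log_mul (left_ne_zero_of_mul_eq_one k1) (right_ne_zero_of_mul_eq_one k1), k1,
        Real.log_one]
    have n1 := hne _ (e.map_source hx)
    have n2 := hne _ (e.map_source hsrc)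
    rw [Real.log_mul (hw.pos _).ne' (abs_ne_zero.2 n2), Real.log_mul (hw.pos _).ne'
      (abs_ne_zero.2 n1), Real.log_abs, Real.log_abs, Real.log_mul (mul_ne_zero (hne' _ hsrc)
      (det_tderiv_flow_ne_zero hφ _ _)) n1, Real.log_mul (hne' _ hsrc)
      (det_tderiv_flow_ne_zero hφ _ _), logJacobian]
    linarith

/-- The divergence of the flow with respect to a smooth density. -/
theorem exists_divergence (hφ : IsSmoothLocallyFree n φ) (hw : IsDensityWeight n w) :
    ∃ g : M → ℝ, ContMDiff (𝓡 n) 𝓘(ℝ, ℝ) ∞ g ∧ ∀ t x, logJacobian n φ w t x = clock φ g t x := by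
  have key : ∀ p : M, ∃ G : EuclideanSpace ℝ (Fin n) → ℝ,
      ContDiffOn ℝ ∞ G (chartAt (EuclideanSpace ℝ (Fin n)) p).target ∧
      ∀ x ∈ (chartAt (EuclideanSpace ℝ (Fin n)) p).source,
        HasDerivAt (fun t => logJacobian n φ w t x)
          (G (chartAt (EuclideanSpace ℝ (Fin n)) p x)) 0 := by
    intro p
    obtain ⟨Ω, Λ, hΩ, h0, hΛ, heq⟩ := exists_logJacobian_in_chart hφ hw p
    set e := chartAt (EuclideanSpace ℝ (Fin n)) p
    refine ⟨fun z => fderiv ℝ Λ (0, z) (1, 0), ?_, fun x hx => ?_⟩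
    · refine ContDiffOn.clm_apply ?_ contDiffOn_const
      exact (hΛ.fderiv_of_isOpen hΩ (by simp)).comp (contDiff_const.prodMk contDiff_id).contDiffOn
        fun z hz => h0 z hz
    · have hmem := h0 _ (e.map_source hx)
      have h1 : HasFDerivAt Λ (fderiv ℝ Λ (0, e x)) (0, e x) :=
        ((hΛ.contDiffAt (hΩ.mem_nhds hmem)).differentiableAt (by simp)).hasFDerivAt
      have h2 : HasDerivAt (fun t : ℝ => (t, e x)) ((1 : ℝ), (0 : EuclideanSpace ℝ (Fin n))) 0 :=
        (hasDerivAt_id _).prodMk (hasDerivAt_const _ _)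
      refine (h1.comp_hasDerivAt 0 h2).congr_of_eventuallyEq ?_
      have hc : Continuous fun t : ℝ => (t, e x) := continuous_id.prodMk continuous_const
      filter_upwards [hc.continuousAt.eventually (hΩ.mem_nhds hmem)] with t ht
      exact heq t x hx ht
  -- The divergence g is defined through the preferred chart of each point; uniqueness of
  -- derivatives identifies it near p with the smooth G p.
  choose G hG hGd using key
  set g : M → ℝ := fun x => G x (chartAt (EuclideanSpace ℝ (Fin n)) x x) with hg_def
  have hgd : ∀ x, HasDerivAt (fun t => logJacobian n φ w t x) (g x) 0 := fun x =>
    hGd x x (mem_chart_source _ x)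
  have hg : ContMDiff (𝓡 n) 𝓘(ℝ, ℝ) ∞ g := by
    intro p
    have he : chartAt (EuclideanSpace ℝ (Fin n)) p ∈ IsManifold.maximalAtlas (𝓡 n) ∞ M :=
      IsManifold.chart_mem_maximalAtlas p
    have h1 : ContMDiffAt 𝓘(ℝ, EuclideanSpace ℝ (Fin n)) 𝓘(ℝ, ℝ) ∞ (G p)
        (chartAt (EuclideanSpace ℝ (Fin n)) p p) :=
      ((hG p).contDiffAt ((chartAt (EuclideanSpace ℝ (Fin n)) p).open_target.mem_nhds
        (mem_chart_target _ p))).contMDiffAt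
    refine (h1.comp p (contMDiffAt_of_mem_maximalAtlas he
      (mem_chart_source _ p))).congr_of_eventuallyEq ?_
    filter_upwards [(chartAt (EuclideanSpace ℝ (Fin n)) p).open_source.mem_nhds (mem_chart_source _ p)] with x hx
    exact (hgd x).unique (hGd p x hx)
  refine ⟨g, hg, fun t x => ?_⟩
  -- The cocycle identity transports the derivative at time 0 to time t.
  have hd : ∀ t, HasDerivAt (fun t => logJacobian n φ w t x) (g (φ t x)) t := by
    intro t
    have h1 := hgd (φ t x)
    rw [← sub_self t] at h1
    have h2 := (HasDerivAt.comp_sub_const t t h1).add_const (logJacobian n φ w t x)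
    refine h2.congr_of_eventuallyEq (Eventually.of_forall fun s => ?_)
    simp only
    rw [← logJacobian_add hφ, sub_add_cancel]
  have hd' : ∀ t, HasDerivAt (fun t => logJacobian n φ w t x - clock φ g t x) 0 t := fun t => by
    simpa using! (hd t).sub (hasDerivAt_clock (φ := φ) hg.continuous t x)
  have h3 := is_const_of_deriv_eq_zero (fun t => (hd' t).differentiableAt)
    (fun t => (hd' t).deriv) t 0
  simp only [logJacobian_zero, clock_zero, sub_self] at h3
  linarith

/-- If all smooth functions are cohomologous to constants, some smooth density is scaled by the
flow at a constant rate. -/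
theorem exists_isDensityWeight_scaled [CompactSpace M] [T2Space M] (hφ : IsSmoothLocallyFree n φ)
    (h : ∀ g : M → ℝ, ContMDiff (𝓡 n) 𝓘(ℝ, ℝ) ∞ g → IsCohomologousToConst n φ g) :
    ∃ (w : M → ℝ) (c : ℝ), IsDensityWeight n w ∧
      ∀ t x, w (φ t x) * |(tderiv n (φ t) x).det| = Real.exp (c * t) * w x := by
  obtain ⟨w, hw⟩ := exists_isDensityWeight (n := n) (M := M)
  obtain ⟨g, hg, hgw⟩ := exists_divergence hφ hw
  obtain ⟨u, c, hu, huc⟩ := h g hg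
  -- The factor e^{−u} absorbs the coboundary, leaving only the linear term ct in the logarithm.
  refine ⟨fun x => Real.exp (-u x) * w x, c,
    hw.smul (Real.contDiff_exp.contMDiff.comp hu.neg) (fun x => Real.exp_pos _), fun t x => ?_⟩
  have h1 := hgw t x
  rw [huc, logJacobian, ← Real.log_abs (tderiv n (φ t) x).det] at h1
  have h2 : w (φ t x) * |(tderiv n (φ t) x).det| =
      Real.exp (u (φ t x) - u x + c * t + Real.log (w x)) := by
    rw [← h1, sub_add_cancel, Real.exp_add, Real.exp_log (hw.pos _),
      Real.exp_log (abs_pos.2 (det_tderiv_flow_ne_zero hφ t x))]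
  simp only
  rw [mul_assoc, h2, ← Real.exp_add]
  conv_rhs => rw [← Real.exp_log (hw.pos x), ← Real.exp_add, ← Real.exp_add]
  congr 1
  ring

end LogJacobian

/-! ### Finite volume rules out a nonzero scaling rate -/

section TotalVolume

variable {n : ℕ} {M : Type*} [TopologicalSpace M] [ChartedSpace (EuclideanSpace ℝ (Fin n)) M]

/-- The expression of the density of weight `w` in the preferred chart at `p`. -/
noncomputable def localDensity (n : ℕ) {M : Type*} [TopologicalSpace M]
    [ChartedSpace (EuclideanSpace ℝ (Fin n)) M] (w : M → ℝ) (p : M)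
    (z : EuclideanSpace ℝ (Fin n)) : ℝ :=
  w ((chartAt (EuclideanSpace ℝ (Fin n)) p).symm z) *
    |(chartSymmDeriv (chartAt (EuclideanSpace ℝ (Fin n)) p) z).det|

variable [IsManifold (𝓡 n) ∞ M] {φ : Flow ℝ M} {w : M → ℝ}

theorem IsDensityWeight.localDensity_pos (hw : IsDensityWeight n w) (p : M)
    {z : EuclideanSpace ℝ (Fin n)} (hz : z ∈ (chartAt (EuclideanSpace ℝ (Fin n)) p).target) :
    0 < localDensity n w p z :=
  mul_pos (hw.pos _) (abs_pos.2 (right_ne_zero_of_mul_eq_one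
    (det_chartDeriv_mul (IsManifold.chart_mem_maximalAtlas p) hz)))

/-- Change of variables for a map that scales a density by the factor `k`. -/
theorem lintegral_localDensity_image {ψ : M → M} (hψ : ContMDiff (𝓡 n) (𝓡 n) ∞ ψ)
    (hinj : Function.Injective ψ) {k : ℝ}
    (hk : ∀ x, w (ψ x) * |(tderiv n ψ x).det| = k * w x) (p q : M)
    {S : Set (EuclideanSpace ℝ (Fin n))} (hS : MeasurableSet S)
    (hSp : S ⊆ (chartAt (EuclideanSpace ℝ (Fin n)) p).target)
    (hSq : ∀ z ∈ S, ψ ((chartAt (EuclideanSpace ℝ (Fin n)) p).symm z) ∈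
      (chartAt (EuclideanSpace ℝ (Fin n)) q).source) :
    ∫⁻ z in (fun z => chartAt (EuclideanSpace ℝ (Fin n)) q
        (ψ ((chartAt (EuclideanSpace ℝ (Fin n)) p).symm z))) '' S,
        ENNReal.ofReal (localDensity n w q z) =
      ∫⁻ z in S, ENNReal.ofReal (k * localDensity n w p z) := by
  simp only [localDensity]
  set e := chartAt (EuclideanSpace ℝ (Fin n)) p
  set e' := chartAt (EuclideanSpace ℝ (Fin n)) q
  have he : e ∈ IsManifold.maximalAtlas (𝓡 n) ∞ M := IsManifold.chart_mem_maximalAtlas p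
  have he' : e' ∈ IsManifold.maximalAtlas (𝓡 n) ∞ M := IsManifold.chart_mem_maximalAtlas q
  rw [lintegral_image_eq_lintegral_abs_det_fderiv_mul volume hS
    (fun z hz => (hasFDerivAt_in_charts he he' hψ (hSp hz) (hSq z hz)).hasFDerivWithinAt) ?_]
  · refine setLIntegral_congr_fun hS fun z hz => ?_
    simp only
    rw [← ENNReal.ofReal_mul (abs_nonneg _), e'.left_inv (hSq z hz), det_comp, det_comp, abs_mul,
      abs_mul, ← mul_assoc k, ← hk]
    congr 1
    have h1 := congrArg abs (det_chartDeriv_mul' he' (hSq z hz))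
    rw [abs_mul, abs_one] at h1
    linear_combination (w (ψ (e.symm z)) * |(tderiv n ψ (e.symm z)).det| *
      |(chartSymmDeriv e z).det|) * h1
  · intro y hy z hz hyz
    exact e.symm.injOn (hSp hy) (hSp hz) (hinj (e'.injOn (hSq y hy) (hSq z hz) hyz))

/-- A flow cannot scale a smooth density on a closed manifold at a nonzero constant rate. -/
theorem scaling_rate_eq_zero [CompactSpace M] [T2Space M] [Nonempty M]
    (hφ : IsSmoothLocallyFree n φ) (hw : IsDensityWeight n w) {c : ℝ}
    (hc : ∀ t x, w (φ t x) * |(tderiv n (φ t) x).det| = Real.exp (c * t) * w x) : c = 0 := by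
  have hC : ∀ x : M, ∃ C ∈ 𝓝 x, C ⊆ (chartAt (EuclideanSpace ℝ (Fin n)) x).source ∧ IsCompact C :=
    fun x => LocallyCompactSpace.local_compact_nhds x _ (chart_source_mem_nhds _ x)
  choose C hCn hCs hCc using hC
  obtain ⟨T, hT⟩ := isCompact_univ.elim_finite_subcover (fun x => interior (C x))
    (fun x => isOpen_interior) (fun x _ => mem_iUnion.2 ⟨x, mem_interior_iff_mem_nhds.2 (hCn x)⟩)
  obtain ⟨p⟩ := ‹Nonempty M›
  have himc : ∀ q, IsCompact (chartAt (EuclideanSpace ℝ (Fin n)) q '' C q) := fun q =>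
    (hCc q).image_of_continuousOn ((chartAt _ q).continuousOn.mono (hCs q))
  have himt : ∀ q, chartAt (EuclideanSpace ℝ (Fin n)) q '' C q ⊆
      (chartAt (EuclideanSpace ℝ (Fin n)) q).target := by
    rintro q _ ⟨x, hx, rfl⟩
    exact (chartAt (EuclideanSpace ℝ (Fin n)) q).map_source (hCs q hx)
  set v : M → ENNReal := fun q => ∫⁻ z in chartAt (EuclideanSpace ℝ (Fin n)) q '' C q,
    ENNReal.ofReal (localDensity n w q z) with hv
  have hcont : ∀ q, ContinuousOn (localDensity n w q)
    (chartAt (EuclideanSpace ℝ (Fin n)) q '' C q) := fun q =>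
      (hw.smooth q).continuousOn.mono (himt q)
  have hvfin : ∀ q, v q < ⊤ := fun q =>
    (((hcont q).integrableOn_compact (himc q)).lintegral_lt_top)
  have hvpos : 0 < v p := by
    refine pos_iff_ne_zero.2 fun h0 => ?_
    rw [hv, lintegral_eq_zero_iff' ((hcont p).integrableOn_compact
      (himc p)).aestronglyMeasurable.aemeasurable.ennreal_ofReal, EventuallyEq,
      ae_restrict_iff' (himc p).measurableSet] at h0
    have h1 : volume (chartAt (EuclideanSpace ℝ (Fin n)) p '' C p) = 0 := by
      refine measure_eq_zero_iff_ae_notMem.2 ?_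
      filter_upwards [h0] with z hz hzC
      exact (ENNReal.ofReal_pos.2 (hw.localDensity_pos p (himt p hzC))).ne' (hz hzC)
    have h2 : IsOpen (chartAt (EuclideanSpace ℝ (Fin n)) p '' interior (C p)) :=
      (chartAt _ p).isOpen_image_of_subset_source isOpen_interior
        (interior_subset.trans (hCs p))
    exact (h2.measure_pos volume ⟨_, mem_image_of_mem _
      (mem_interior_iff_mem_nhds.2 (hCn p))⟩).ne' (measure_mono_null (image_mono interior_subset) h1)
  -- The image under φ^t of the compact set C p has volume e^{ct}·v p and is covered by the finitely
  -- many C q, so a bound independent of t results.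
  have hle : ∀ t, ENNReal.ofReal (Real.exp (c * t)) * v p ≤ ∑ q ∈ T, v q := by
    intro t
    set e := chartAt (EuclideanSpace ℝ (Fin n)) p
    let S : M → Set (EuclideanSpace ℝ (Fin n)) := fun q => e '' (C p ∩ φ t ⁻¹' C q)
    have hSc : ∀ q, IsCompact (S q) := fun q =>
      ((hCc p).inter_right ((hCc q).isClosed.preimage (hφ.contMDiff_apply t).continuous)
        ).image_of_continuousOn (e.continuousOn.mono (inter_subset_left.trans (hCs p)))
    have hSp : ∀ q, S q ⊆ e.target := fun q => (image_mono inter_subset_left).trans (himt p)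
    have hSq : ∀ q, ∀ z ∈ S q, φ t (e.symm z) ∈ C q := by
      rintro q _ ⟨x, ⟨hx, hx'⟩, rfl⟩
      rw [e.left_inv (hCs p hx)]
      exact hx'
    have hcov : e '' C p ⊆ ⋃ q ∈ T, S q := by
      rintro _ ⟨x, hx, rfl⟩
      obtain ⟨q, hqT, hq⟩ := mem_iUnion₂.1 (hT (mem_univ (φ t x)))
      exact mem_iUnion₂.2 ⟨q, hqT, mem_image_of_mem _ ⟨hx, mem_preimage.2 (interior_subset hq)⟩⟩
    calc ENNReal.ofReal (Real.exp (c * t)) * v p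
        = ∫⁻ z in e '' C p, ENNReal.ofReal (Real.exp (c * t) * localDensity n w p z) := by
          simp only [ENNReal.ofReal_mul (Real.exp_pos _).le]
          rw [lintegral_const_mul' _ _ ENNReal.ofReal_ne_top]
      _ ≤ ∫⁻ z in ⋃ q ∈ T, S q, ENNReal.ofReal (Real.exp (c * t) * localDensity n w p z) :=
          lintegral_mono_set hcov
      _ ≤ ∑ q ∈ T, ∫⁻ z in S q, ENNReal.ofReal (Real.exp (c * t) * localDensity n w p z) := by
          have h1 := lintegral_iUnion_le (μ := volume) (fun q : T => S q)
            fun z => ENNReal.ofReal (Real.exp (c * t) * localDensity n w p z)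
          rw [tsum_fintype, Finset.sum_coe_sort T fun q => ∫⁻ z in S q,
            ENNReal.ofReal (Real.exp (c * t) * localDensity n w p z)] at h1
          exact (lintegral_mono_set (biUnion_eq_iUnion (T : Set M) fun q _ => S q).subset).trans h1
      _ ≤ ∑ q ∈ T, v q := by
          refine Finset.sum_le_sum fun q _ => ?_
          rw [← lintegral_localDensity_image (hφ.contMDiff_apply t) (φ.toHomeomorph t).injective
            (hc t) p q (hSc q).measurableSet (hSp q) fun z hz => hCs q (hSq q z hz)]
          refine lintegral_mono_set ?_
          rintro _ ⟨z, hz, rfl⟩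
          exact mem_image_of_mem _ (hSq q z hz)
  by_contra hc0
  set B := ∑ q ∈ T, v q with hB
  have hBfin : B < ⊤ := ENNReal.sum_lt_top.2 fun q _ => hvfin q
  have hreal : ∀ t, Real.exp (c * t) * (v p).toReal ≤ B.toReal := fun t => by
    have := ENNReal.toReal_mono hBfin.ne (hle t)
    rwa [ENNReal.toReal_mul, ENNReal.toReal_ofReal (Real.exp_pos _).le] at this
  have hvp : 0 < (v p).toReal := ENNReal.toReal_pos hvpos.ne' (hvfin p).ne
  -- With B the finite bound, the time is chosen so that ct = B/v, giving e^{B/v} ≤ B/v, which is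
  -- impossible.
  have h1 := hreal (B.toReal / (v p).toReal / c)
  rw [mul_div_cancel₀ _ hc0, ← le_div_iff₀ hvp] at h1
  linarith [Real.add_one_le_exp (B.toReal / (v p).toReal)]

end TotalVolume

/-! ### From weights to densities -/

section Density

/-- The standard basis of `ℝⁿ`. -/
noncomputable def stdBasis (n : ℕ) : Module.Basis (Fin n) ℝ (EuclideanSpace ℝ (Fin n)) :=
  (EuclideanSpace.basisFun (Fin n) ℝ).toBasis

theorem stdBasis_apply (n : ℕ) (i : Fin n) : stdBasis n i = EuclideanSpace.single i (1 : ℝ) := by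
  simp [stdBasis]

theorem stdBasis_det_map {n : ℕ} (A : EuclideanSpace ℝ (Fin n) →L[ℝ] EuclideanSpace ℝ (Fin n))
    (v : Fin n → EuclideanSpace ℝ (Fin n)) :
    (stdBasis n).det (fun i => A (v i)) = A.det * (stdBasis n).det v :=
  (stdBasis n).det_comp A.toLinearMap v

theorem stdBasis_det_ne_zero {n : ℕ} {v : Fin n → EuclideanSpace ℝ (Fin n)}
    (hv : LinearIndependent ℝ v) : (stdBasis n).det v ≠ 0 :=
  (((stdBasis n).is_basis_iff_det).1
    ⟨hv, hv.span_eq_top_of_card_eq_finrank' (by simp)⟩).ne_zero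

theorem stdBasis_det_map_single {n : ℕ}
    (A : EuclideanSpace ℝ (Fin n) →L[ℝ] EuclideanSpace ℝ (Fin n)) :
    (stdBasis n).det (fun i => A (EuclideanSpace.single i (1 : ℝ))) = A.det := by
  have h := stdBasis_det_map A (stdBasis n)
  rw [Module.Basis.det_self, mul_one] at h
  simpa only [stdBasis_apply] using h

variable {n : ℕ} {M : Type*} [TopologicalSpace M] [ChartedSpace (EuclideanSpace ℝ (Fin n)) M]

/-- The smoothness condition on frames, for multiples of the coordinate determinant. -/
theorem isSmoothOnFrames_of_det (η : M → (Fin n → EuclideanSpace ℝ (Fin n)) → ℝ)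
    (h : ∀ p : M, ContDiffOn ℝ ∞ (fun z => η ((chartAt (EuclideanSpace ℝ (Fin n)) p).symm z)
      fun i => chartSymmDeriv (chartAt (EuclideanSpace ℝ (Fin n)) p) z
        (EuclideanSpace.single i (1 : ℝ))) (chartAt (EuclideanSpace ℝ (Fin n)) p).target) :
    IsSmoothOnFrames n M η := by
  intro p
  have ht : (extChartAt (𝓡 n) p).target = (chartAt (EuclideanSpace ℝ (Fin n)) p).target := by
    simp [mfld_simps]
  rw [ht]
  exact h p

variable {φ : Flow ℝ M} {w : M → ℝ}

/-- The smooth density with a given weight. -/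
noncomputable def IsDensityWeight.toPositiveDensity (hw : IsDensityWeight n w) :
    PositiveDensity n M where
  toFun x v := w x * |(stdBasis n).det (v : Fin n → EuclideanSpace ℝ (Fin n))|
  map_linear x A v := by
    have h := (stdBasis n).det_comp (A : EuclideanSpace ℝ (Fin n) →ₗ[ℝ] EuclideanSpace ℝ (Fin n)) v
    have h2 := congrArg abs h
    rw [abs_mul] at h2
    rw [mul_left_comm]
    exact congrArg (w x * ·) h2
  pos x v hv := by
    refine mul_pos (hw.pos x) (abs_pos.2 ?_)
    exact stdBasis_det_ne_zero hv
  smooth := by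
    refine isSmoothOnFrames_of_det (fun x v => w x * |(stdBasis n).det v|) fun p => ?_
    simp only [stdBasis_det_map_single]
    exact hw.smooth p

theorem IsDensityWeight.isInvariant_toPositiveDensity (hw : IsDensityWeight n w)
    (hinv : ∀ t x, w (φ t x) * |(tderiv n (φ t) x).det| = w x) :
    hw.toPositiveDensity.IsInvariant φ := by
  intro t x v
  have h := stdBasis_det_map (tderiv n (φ t) x) v
  change w (φ t x) * |(stdBasis n).det fun i => tderiv n (φ t) x (v i)| = w x * |(stdBasis n).det v|
  rw [h, abs_mul, ← mul_assoc, hinv]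

end Density

/-! ### The invariant volume form in the orientable case -/

section Orientation

variable {n : ℕ} {M : Type*} [TopologicalSpace M] [ChartedSpace (EuclideanSpace ℝ (Fin n)) M]

/-- A function with values `±1` giving an orientation: near each point some chart is positively
oriented at exactly the points where the function is `1`. -/
def IsOrientationSign (n : ℕ) {M : Type*} [TopologicalSpace M]
    [ChartedSpace (EuclideanSpace ℝ (Fin n)) M] (σ : M → ℝ) : Prop :=
  (∀ x, |σ x| = 1) ∧ ∀ x, ∃ a ∈ IsManifold.maximalAtlas (𝓡 n) ∞ M, x ∈ a.source ∧
    ∀ y ∈ a.source, 0 < σ y * (chartDeriv a y).det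

variable [IsManifold (𝓡 n) ∞ M] {φ : Flow ℝ M} {w σ : M → ℝ}

/-- The sign at x is that of the determinant of an atlas chart at x. It agrees on the whole source
of any other atlas chart because the coordinate changes have positive determinant. -/
theorem IsOrientable.exists_isOrientationSign (h : IsOrientable n M) :
    ∃ σ : M → ℝ, IsOrientationSign n σ := by
  obtain ⟨𝒜, h𝒜, hcov, hpos⟩ := h
  choose e he hxe using hcov
  refine ⟨fun x => if 0 < (chartDeriv (e x) x).det then 1 else -1, fun x => ?_, fun x =>
    ⟨e x, h𝒜 (he x), hxe x, fun y hy => ?_⟩⟩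
  · dsimp only
    split_ifs <;> simp
  · have hz : e y y ∈ (e y).target := (e y).map_source (hxe y)
    have h1 := hpos (e y) (he y) (e x) (he x) (e y y) (by
      rw [OpenPartialHomeomorph.trans_source, OpenPartialHomeomorph.symm_source]
      exact ⟨hz, by rwa [mem_preimage, (e y).left_inv (hxe y)]⟩)
    rw [det_fderiv_coord_change (h𝒜 (he y)) (h𝒜 (he x)) hz (by rwa [(e y).left_inv (hxe y)]),
      (e y).left_inv (hxe y)] at h1
    have h2 := det_chartDeriv_mul' (h𝒜 (he y)) (hxe y)
    dsimp only
    split_ifs with h3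
    · rw [one_mul]
      have h4 : 0 < (chartSymmDeriv (e y) (e y y)).det := by
        by_contra h5
        nlinarith [mul_nonneg h3.le (sub_nonneg.2 (not_lt.1 h5))]
      exact pos_of_mul_pos_left h1 h4.le
    · have h4 : (chartSymmDeriv (e y) (e y y)).det < 0 := by
        by_contra h5
        nlinarith [mul_nonneg (sub_nonneg.2 (not_lt.1 h3)) (not_lt.1 h5)]
      nlinarith [neg_of_mul_pos_left h1 h4.le]

theorem IsOrientationSign.mul_self (hσ : IsOrientationSign n σ) (x : M) : σ x * σ x = 1 := by
  rw [← abs_mul_abs_self, hσ.1, one_mul]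

/-- Locally the expression is the smooth density up to a constant sign: the sign is that of a
coordinate change determinant, continuous and nonzero. -/
theorem IsOrientationSign.contDiffOn (hσ : IsOrientationSign n σ) (hw : IsDensityWeight n w)
    (p : M) :
    ContDiffOn ℝ ∞ (fun z => w ((chartAt (EuclideanSpace ℝ (Fin n)) p).symm z) *
      σ ((chartAt (EuclideanSpace ℝ (Fin n)) p).symm z) *
        (chartSymmDeriv (chartAt (EuclideanSpace ℝ (Fin n)) p) z).det)
      (chartAt (EuclideanSpace ℝ (Fin n)) p).target := by
  have hr := hw.smooth p
  set e := chartAt (EuclideanSpace ℝ (Fin n)) p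
  have he : e ∈ IsManifold.maximalAtlas (𝓡 n) ∞ M := IsManifold.chart_mem_maximalAtlas p
  intro z hz
  refine ContDiffAt.contDiffWithinAt ?_
  have hrz := hr.contDiffAt (e.open_target.mem_nhds hz)
  obtain ⟨a, ha, hza, hpos⟩ := hσ.2 (e.symm z)
  have hO := (isOpen_coord_change_domain e a).mem_nhds ⟨hz, hza⟩
  have hG : ContinuousAt (fun z => (fderiv ℝ (fun z => a (e.symm z)) z).det) z := by
    refine ContDiffAt.continuousAt (n := ∞) (𝕜 := ℝ) (contDiff_det.contDiffAt.comp z ?_)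
    exact ((contDiffOn_coord_change he ha).contDiffAt hO).fderiv_right (by simp)
  have hsign : ∀ y ∈ e.target ∩ e.symm ⁻¹' a.source, 0 < σ (e.symm y) *
      (chartSymmDeriv e y).det * (fderiv ℝ (fun z => a (e.symm z)) y).det := by
    intro y hy
    rw [det_fderiv_coord_change he ha hy.1 hy.2]
    have h1 := mul_pos (hpos _ hy.2) (mul_self_pos.2 (right_ne_zero_of_mul_eq_one
      (det_chartDeriv_mul he hy.1)))
    linarith
  rcases lt_or_gt_of_ne (right_ne_zero_of_mul (hsign z ⟨hz, hza⟩).ne') with h0 | h0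
  · refine hrz.neg.congr_of_eventuallyEq ?_
    filter_upwards [hO, hG.eventually (gt_mem_nhds h0)] with y hy hy0
    have h1 := neg_of_mul_pos_left (hsign y hy) hy0.le
    have h2 := abs_of_neg h1
    rw [abs_mul, hσ.1, one_mul] at h2
    rw [h2]
    ring
  · refine hrz.congr_of_eventuallyEq ?_
    filter_upwards [hO, hG.eventually (lt_mem_nhds h0)] with y hy hy0
    have h1 := pos_of_mul_pos_left (hsign y hy) hy0.le
    have h2 := abs_of_pos h1
    rw [abs_mul, hσ.1, one_mul] at h2
    rw [h2]
    ring

/-- In a chart adapted to the sign, the spatial Jacobian of the flow is continuous in s and equals 1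
at s = 0. -/
theorem IsOrientationSign.eventually_flow (hσ : IsOrientationSign n σ)
    (hφ : IsSmoothLocallyFree n φ) (y : M) :
    ∀ᶠ s in 𝓝 (0 : ℝ), 0 < σ (φ s y) * (tderiv n (φ s) y).det * σ y := by
  obtain ⟨a, ha, hya, hpos⟩ := hσ.2 y
  obtain ⟨Ω, hΩ, h0, hΩm, -, hD⟩ := exists_flow_in_chart hφ ha
  have hmem := h0 _ (a.map_source hya)
  have hline : ContinuousAt (fun s : ℝ => (s, a y)) 0 :=
    (continuous_id.prodMk continuous_const).continuousAt
  have hc := (hD.continuousOn.continuousAt (hΩ.mem_nhds hmem)).comp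
    (f := fun s : ℝ => (s, a y)) hline
  have hpos0 : (0 : ℝ) < ((fun q : ℝ × EuclideanSpace ℝ (Fin n) =>
      (chartDeriv a (φ q.1 (a.symm q.2))).det * (tderiv n (φ q.1) (a.symm q.2)).det *
        (chartSymmDeriv a q.2).det) ∘ fun s : ℝ => (s, a y)) 0 := by
    simp only [Function.comp_apply, a.left_inv hya, φ.map_zero_apply]
    rw [flow_zero_eq_id, tderiv_id, det_id, mul_one, det_chartDeriv_mul' ha hya]
    exact one_pos
  filter_upwards [hc.eventually (lt_mem_nhds hpos0), hline.eventually (hΩ.mem_nhds hmem)]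
    with s hs hsΩ
  simp only [Function.comp_apply, a.left_inv hya] at hs
  have hsrc := (hΩm _ hsΩ).2
  simp only [a.left_inv hya] at hsrc
  have h1 := mul_pos (mul_pos hs (hpos _ hsrc)) (hpos y hya)
  have h2 := det_chartDeriv_mul' ha hya
  have h3 : 0 < (σ (φ s y) * (tderiv n (φ s) y).det * σ y) *
      ((chartDeriv a (φ s y)).det * (chartDeriv a (φ s y)).det) := by
    linear_combination h1 + (σ (φ s y) * (tderiv n (φ s) y).det * σ y) *
      ((chartDeriv a (φ s y)).det * (chartDeriv a (φ s y)).det) * h2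
  exact pos_of_mul_pos_left h3 (mul_self_nonneg _)

/-- For small times the Jacobian has the sign that removes the absolute value. The cocycle identity
then makes the left side locally constant in t, hence constant on ℝ. -/
theorem IsOrientationSign.mul_det_tderiv (hσ : IsOrientationSign n σ)
    (hφ : IsSmoothLocallyFree n φ)
    (hinv : ∀ t x, w (φ t x) * |(tderiv n (φ t) x).det| = w x) (t : ℝ) (x : M) :
    w (φ t x) * σ (φ t x) * (tderiv n (φ t) x).det = w x * σ x := by
  have hsmall : ∀ y, ∀ᶠ s in 𝓝 (0 : ℝ),
      w (φ s y) * σ (φ s y) * (tderiv n (φ s) y).det = w y * σ y := by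
    intro y
    filter_upwards [hσ.eventually_flow hφ y] with s hs
    have h2 := abs_of_pos hs
    rw [abs_mul, abs_mul, hσ.1, hσ.1, one_mul, mul_one] at h2
    have h3 := hinv s y
    rw [h2] at h3
    linear_combination σ y * h3 - w (φ s y) * σ (φ s y) * (tderiv n (φ s) y).det * hσ.mul_self y
  have hloc : IsLocallyConstant fun t => w (φ t x) * σ (φ t x) * (tderiv n (φ t) x).det := by
    rw [IsLocallyConstant.iff_eventually_eq]
    intro t
    have hc : Tendsto (fun s => s - t) (𝓝 t) (𝓝 0) := by
      simpa using (continuous_sub_right t).tendsto t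
    filter_upwards [hc.eventually (hsmall (φ t x))] with s hs
    have h1 := tderiv_flow_add hφ (s - t) t x
    rw [← φ.map_add, sub_add_cancel] at hs
    rw [sub_add_cancel] at h1
    rw [h1, det_comp, ← mul_assoc, hs]
  have h := hloc.apply_eq_of_preconnectedSpace t 0
  simp only [φ.map_zero_apply] at h
  rwa [flow_zero_eq_id, tderiv_id, det_id, mul_one] at h

/-- The volume form attached to a smooth density and an orientation. -/
noncomputable def IsOrientationSign.toVolumeForm (hσ : IsOrientationSign n σ)
    (hw : IsDensityWeight n w) : VolumeForm n M where
  toFun x := ((w x * σ x) • (stdBasis n).det :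
    EuclideanSpace ℝ (Fin n) [⋀^Fin n]→ₗ[ℝ] ℝ)
  smooth := by
    refine isSmoothOnFrames_of_det (fun x v => w x * σ x * (stdBasis n).det v) fun p => ?_
    simp only [stdBasis_det_map_single]
    exact hσ.contDiffOn hw p
  ne_zero x h := by
    have h1 : ((w x * σ x) • (stdBasis n).det :
      EuclideanSpace ℝ (Fin n) [⋀^Fin n]→ₗ[ℝ] ℝ) (stdBasis n) = 0 := by
      exact congrArg (fun f : EuclideanSpace ℝ (Fin n) [⋀^Fin n]→ₗ[ℝ] ℝ => f (stdBasis n)) h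
    rw [AlternatingMap.smul_apply, Module.Basis.det_self, smul_eq_mul, mul_one] at h1
    have h2 := hσ.mul_self x
    rw [(mul_eq_zero.1 h1).resolve_left (hw.pos x).ne'] at h2
    simp at h2

theorem IsOrientationSign.isInvariant_toVolumeForm (hσ : IsOrientationSign n σ)
    (hw : IsDensityWeight n w) (hφ : IsSmoothLocallyFree n φ)
    (hinv : ∀ t x, w (φ t x) * |(tderiv n (φ t) x).det| = w x) :
    (hσ.toVolumeForm hw).IsInvariant φ := by
  intro t x v
  have h := stdBasis_det_map (tderiv n (φ t) x) v
  change w (φ t x) * σ (φ t x) * ((stdBasis n).det fun i => tderiv n (φ t) x (v i)) =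
    w x * σ x * (stdBasis n).det v
  rw [h, ← mul_assoc, hσ.mul_det_tderiv hφ hinv]

end Orientation

end ParamRigid

theorem mainTheorem6 (n : ℕ) (M : Type*) [TopologicalSpace M] [T2Space M] [CompactSpace M]
    [Nonempty M] [ChartedSpace (EuclideanSpace ℝ (Fin n)) M] [IsManifold (𝓡 n) ∞ M]
    [MeasurableSpace M] [BorelSpace M]
    (φ : Flow ℝ M) (hφ : ParamRigid.IsSmoothLocallyFree n φ)
    (hrigid : ParamRigid.IsParameterRigid n φ) :
    ParamRigid.IsUniquelyErgodic φ ∧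
    (∃ ρ : ParamRigid.PositiveDensity n M, ρ.IsInvariant φ) ∧
    (ParamRigid.IsOrientable n M → ∃ η : ParamRigid.VolumeForm n M, η.IsInvariant φ) := by
  have hcob := fun g hg => hrigid.isCohomologousToConst hφ (g := g) hg
  obtain ⟨w, c, hw, hc⟩ := ParamRigid.exists_isDensityWeight_scaled hφ hcob
  have hinv : ∀ t x, w (φ t x) * |(ParamRigid.tderiv n (φ t) x).det| = w x := fun t x => by
    rw [hc, ParamRigid.scaling_rate_eq_zero hφ hw hc, zero_mul, Real.exp_zero, one_mul]
  refine ⟨ParamRigid.isUniquelyErgodic_of_isCohomologousToConst hcob,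
    ⟨hw.toPositiveDensity, hw.isInvariant_toPositiveDensity hinv⟩, fun ho => ?_⟩
  obtain ⟨σ, hσ⟩ := ho.exists_isOrientationSign
  exact ⟨hσ.toVolumeForm hw, hσ.isInvariant_toVolumeForm hw hφ hinv⟩
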